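/- An election $E=(C,V)$ consists of a finite set $C$ of candidates and a finite set $V$ of voters, each voter $v$ submitting a ranking (strict total order) $\succ_v$ of $C$. For $C'\subseteq C$ and $V'\subseteq V$, the subelection $(C',V')$ is obtained by restricting the rankings of the voters in $V'$ to $C'$; it is an identity election if all voters in $V'$ have the same restricted ranking. In the problem Hidden-ID one is given an election $E=(C,V)$ and $m',n'\in\mathbb N$ and asks whether $E$ has an identity subelection $(C',V')$ with $|C'|\ge m'$ and $|V'|\ge n'$. The input $x$ is a string that writes $m'$ and $n'$ in binary and lists all candidates and then, for every voter, all candidates from the most to the least preferred one; $|x|$ is its length. Corollary. (1) Hidden-ID is in FPT for the parameterization by the number of candidates $|C|$: there are a computable function $f:\mathbb N\to\mathbb N$, a polynomial $p$ and a Turing machine that decides every instance $x$ in at most $f(|C|)\cdot p(|x|)$ steps. (2) Hidden-ID is in XP for the parameterization by the requested number $m'$ of candidates in the solution: there are a computable function $g:\mathbb N\to\mathbb N$ and a Turing machine that decides every instance $x$ in at most $|x|^{g(m')}+g(m')$ steps. -/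

import Mathlib

/-! ### Ordinal elections -/

/-- An ordinal election with candidates `C` and voters `V`: every voter `v` submits a ranking of
the candidates, that is, a strict total order; `E.pref v c d` says that `v` prefers `c` to `d`. -/
structure Election (C V : Type) where
  pref : V → C → C → Prop
  ranking : ∀ v, IsStrictTotalOrder C (pref v)

namespace Election

/-- The subelection `(C', V')`: the voters of `V'` compare the candidates of `C'` as in `E`. -/
def sub {C V : Type} (E : Election C V) (C' : Finset C) (V' : Finset V) :
    Election {c // c ∈ C'} {v // v ∈ V'} where
  pref v c d := E.pref v.1 c.1 d.1
  ranking v :=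
    haveI := E.ranking v.1
    { trichotomous := fun c d h₁ h₂ =>
        Subtype.ext ((E.ranking v.1).trichotomous c.1 d.1 h₁ h₂)
      irrefl := fun c => (E.ranking v.1).irrefl c.1
      trans := fun c d e => (E.ranking v.1).trans c.1 d.1 e.1 }

/-- An identity election: all voters have the same ranking. -/
def IsIdentity {C V : Type} (E : Election C V) : Prop :=
  ∀ v w : V, E.pref v = E.pref w

open Classical in
/-- The ranking of voter `v` as a list of all candidates, most preferred candidate first. -/
noncomputable def rankingList {m : ℕ} {V : Type} (E : Election (Fin m) V) (v : V) :
    List (Fin m) :=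
  (List.finRange m).mergeSort (fun c d => decide (c = d ∨ E.pref v c d))

theorem rankingList_perm {m : ℕ} {V : Type} (E : Election (Fin m) V) (v : V) :
    (E.rankingList v).Perm (List.finRange m) :=
  List.mergeSort_perm _ _

theorem rankingList_pairwise {m : ℕ} {V : Type} (E : Election (Fin m) V) (v : V) :
    (E.rankingList v).Pairwise (E.pref v) := by
  classical
  have hn : (E.rankingList v).Nodup :=
    (E.rankingList_perm v).nodup_iff.2 (List.nodup_finRange m)
  have hs : (E.rankingList v).Pairwise (fun c d => c = d ∨ E.pref v c d) := by
    have := List.pairwise_mergeSort (le := fun c d => decide (c = d ∨ E.pref v c d))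
      (by
        intro a b c hab hbc
        simp only [decide_eq_true_eq] at *
        rcases hab with rfl | hab
        · exact hbc
        · rcases hbc with rfl | hbc
          · exact Or.inr hab
          · exact Or.inr ((E.ranking v).trans _ _ _ hab hbc))
      (by
        intro a b
        simp only [Bool.or_eq_true, decide_eq_true_eq]
        by_contra! h
        exact h.1.1 ((E.ranking v).trichotomous a b h.1.2 h.2.2))
      (List.finRange m)
    unfold rankingList
    convert this using 3
    simp
  exact hs.imp₂ (fun a b h hne => h.resolve_left hne) hn

end Election

/-! ### The problem Hidden-ID -/

/-- An input of Hidden-ID: an election whose candidates and voters are numbered, together with the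
requested numbers of candidates and of voters of the identity subelection. -/
structure HiddenIDInstance where
  numCandidates : ℕ
  numVoters : ℕ
  election : Election (Fin numCandidates) (Fin numVoters)
  minCandidates : ℕ
  minVoters : ℕ

/-- The yes-instances of Hidden-ID. -/
def HiddenID : Set HiddenIDInstance :=
  {I | ∃ (C' : Finset (Fin I.numCandidates)) (V' : Finset (Fin I.numVoters)),
    (I.election.sub C' V').IsIdentity ∧ I.minCandidates ≤ C'.card ∧ I.minVoters ≤ V'.card}

/-- The tape alphabet used to write down inputs: binary digits and two kinds of delimiters. -/
inductive InputSymbol where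
  | bit (b : Bool)
  | comma
  | bar

/-- A natural number in binary (least significant digit first), ended by a comma. -/
def encodeNumber (k : ℕ) : List InputSymbol :=
  k.bits.map InputSymbol.bit ++ [InputSymbol.comma]

/-- A list of numbers, ended by a bar. -/
def encodeNumbers (l : List ℕ) : List InputSymbol :=
  l.flatMap encodeNumber ++ [InputSymbol.bar]

/-- The input as a string: the two requested numbers in binary, the list of all candidates, and
then, voter by voter, the list of all candidates from the most to the least preferred one. -/
noncomputable def HiddenIDInstance.encode (I : HiddenIDInstance) : List InputSymbol :=
  encodeNumber I.minCandidates ++ encodeNumber I.minVoters ++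
    encodeNumbers ((List.finRange I.numCandidates).map Fin.val) ++
    (List.finRange I.numVoters).flatMap
      (fun v => encodeNumbers ((I.election.rankingList v).map Fin.val))

/-! ### Parameterized complexity -/

/-- The decision problem `L`, whose inputs `a` are written as strings `enc a`, is decided by one
(multi-stack) Turing machine that on every input `a` halts after at most `T a` steps, with output
`true` if `a ∈ L` and output `false` otherwise. -/
def DecidableInTime {α Γ : Type} (enc : α → List Γ) (L : Set α) (T : α → ℕ) : Prop :=
  ∃ M : Turing.TM2ComputableAux Γ Bool, ∀ a : α, ∃ b : Bool, (b = true ↔ a ∈ L) ∧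
    Nonempty (Turing.TM2OutputsInTime M.tm ((enc a).map M.inputAlphabet.symm)
      (some ([b].map M.outputAlphabet.symm)) (T a))

/-- Fixed-parameter tractability of `L` with respect to the parameter `κ`: time
`f (κ a) * p |a|` for a computable function `f` and a polynomial `p`. -/
def InFPT {α Γ : Type} (enc : α → List Γ) (L : Set α) (κ : α → ℕ) : Prop :=
  ∃ (f : ℕ → ℕ) (p : Polynomial ℕ), Computable f ∧
    DecidableInTime enc L (fun a => f (κ a) * p.eval (enc a).length)

/-- Membership of `L` with parameter `κ` in (uniform) XP: time
`|a| ^ f (κ a) + f (κ a)` for a computable function `f`. -/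
def InXP {α Γ : Type} (enc : α → List Γ) (L : Set α) (κ : α → ℕ) : Prop :=
  ∃ f : ℕ → ℕ, Computable f ∧
    DecidableInTime enc L (fun a => (enc a).length ^ f (κ a) + f (κ a))

/-! Rankings that agree on a set of candidates list that set in the same order. So an identity
subelection with `m'` candidates and `n'` voters exists iff `m' ≤ |C|`, `n' ≤ |V|`, and some list of
`m'` candidates is a subsequence of at least `n'` rankings (`mem_hiddenID_iff`). Only `|C| ^ m'`
lists have to be tried, each in polynomial time. Both claims follow from this one algorithm: a
search with `m' > |C|` is hopeless, so the exponent is `min m' |C|`. Bounding it by `|C|` gives FPT;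
bounding it by `m'` and the base by `|x|` gives XP.

All lists are tried in parallel. A state is the list of what remains of the rankings after deleting
everything up to a greedy embedding of a list `s`, where rankings not containing `s` are dropped. A
level holds the states of all `s` of a given length. One round extends every `s` by every candidate
and multiplies the size of the level by at most `|C|` (`length_encLevel_stepLevel`). Greedy
embedding is complete (`isSome_dropSeq`), so after `m'` rounds it remains to look for a state with
at least `n'` rankings (`exists_mem_iterate_stepLevel`).

To get an actual machine with a step bound, the algorithm is written in a small language of stack
programs whose big-step semantics `Exec` carries the time. `Exec.machineRun` turns every such
execution into a run of a multi-stack machine within the same bound, and `exec_hiddenIDProg` gives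
correctness and time of the whole program. Since `m'` and `n'` are binary, they may be exponential
in `|x|`; they are never expanded to unary beyond `|C|` and `|V|` (`exec_moveCount`). -/

/-! ### Structured programs over finitely many stacks -/

/-- Structured programs that work on stacks with alphabet `A`, indexed by `K`. A program can only
inspect the tops of the stacks. -/
inductive StackProg (K A : Type) : Type
  | skip : StackProg K A
  | push (k : K) (a : A) : StackProg K A
  | pop (k : K) : StackProg K A
  | seq (p q : StackProg K A) : StackProg K A
  | switch (k : K) (f : Option A → StackProg K A) : StackProg K A
  | loop (k : K) (c : Option A → Bool) (p : StackProg K A) : StackProg K A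

namespace StackProg

variable {K A : Type}

/-- Sequential composition of programs. -/
infixr:60 " ;; " => StackProg.seq

/-- `Exec p S T S'`: started with stacks `S`, the program `p` ends with stacks `S'` after at most
`T` steps. -/
inductive Exec [DecidableEq K] :
    StackProg K A → (K → List A) → ℕ → (K → List A) → Prop
  | skip (S) : Exec skip S 1 S
  | push (k a S) : Exec (push k a) S 1 (Function.update S k (a :: S k))
  | pop (k S) : Exec (pop k) S 1 (Function.update S k (S k).tail)
  | seq {p q S₁ S₂ S₃ t₁ t₂} : Exec p S₁ t₁ S₂ → Exec q S₂ t₂ S₃ →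
      Exec (p ;; q) S₁ (t₁ + t₂) S₃
  | switch {k f S S' t} : Exec (f (S k).head?) S t S' → Exec (switch k f) S (t + 1) S'
  | loop_end {k c p S} : c (S k).head? = false → Exec (loop k c p) S 1 S
  | loop_step {k c p S₁ S₂ S₃ t₁ t₂} : c (S₁ k).head? = true → Exec p S₁ t₁ S₂ →
      Exec (loop k c p) S₂ t₂ S₃ → Exec (loop k c p) S₁ (t₁ + t₂ + 1) S₃
  | mono {p S S' t T} : Exec p S t S' → t ≤ T → Exec p S T S'

/-! ### Compilation of stack programs to machine statements. -/

/-- The control points of a program. -/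
def Pos : StackProg K A → Type
  | skip => Unit
  | push _ _ => Unit
  | pop _ => Unit
  | seq p q => Pos p ⊕ Pos q
  | switch _ f => Option (Σ x, Pos (f x))
  | loop _ _ p => Option (Pos p)

noncomputable instance instFintypePos [Fintype A] : (p : StackProg K A) → Fintype (Pos p)
  | skip => inferInstanceAs (Fintype Unit)
  | push _ _ => inferInstanceAs (Fintype Unit)
  | pop _ => inferInstanceAs (Fintype Unit)
  | seq p q =>
    haveI := instFintypePos p
    haveI := instFintypePos q
    inferInstanceAs (Fintype (Pos p ⊕ Pos q))
  | switch _ f =>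
    haveI := fun x => instFintypePos (f x)
    inferInstanceAs (Fintype (Option (Σ x, Pos (f x))))
  | loop _ _ p =>
    haveI := instFintypePos p
    inferInstanceAs (Fintype (Option (Pos p)))

/-- The control point where the execution of a program starts. -/
def entry : (p : StackProg K A) → Pos p
  | skip => ()
  | push _ _ => ()
  | pop _ => ()
  | seq p _ => Sum.inl (entry p)
  | switch _ _ => none
  | loop _ _ _ => none

/-- The stack alphabets of the machine for a program: an input stack, an output stack, and the
stacks of the program. -/
def Alphabet (K A I : Type) : Bool ⊕ K → Type
  | Sum.inl false => I
  | Sum.inl true => Bool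
  | Sum.inr _ => A

/-- The stacks of the machine, with empty output stack. -/
def store {I : Type} (i : List I) (S : K → List A) : (k : Bool ⊕ K) → List (Alphabet K A I k)
  | Sum.inl false => i
  | Sum.inl true => []
  | Sum.inr k => S k

theorem update_store [DecidableEq K] {I : Type} (i : List I) (S : K → List A) (k : K)
    (l : List A) : Function.update (store i S) (Sum.inr k) l =
      store i (Function.update S k l) := by
  funext j
  rcases j with (_ | _) | j
  · rfl
  · rfl
  · by_cases h : j = k
    · subst h
      exact (Function.update_self ..).trans (Function.update_self (β := fun _ => List A) j l S).symm
    · exact (Function.update_of_ne (by simpa using h) ..).trans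
        (Function.update_of_ne (β := fun _ => List A) h l S).symm

theorem update_store_input [DecidableEq K] {I : Type} (i i' : List I) (S : K → List A) :
    Function.update (store i S) (Sum.inl false) i' = store i' S := by
  funext j
  rcases j with (_ | _) | j <;> rfl

/-- The statements of the machine for a program whose control points are the labels in the range
of `emb` and which continues at the label `exit`. -/
def compile {I Λ : Type} : (p : StackProg K A) → (Pos p → Λ) → Λ → Pos p →
    Turing.TM2.Stmt (Alphabet K A I) Λ (Option A)
  | skip, _, exit, _ => .goto fun _ => exit
  | push k a, _, exit, _ => .push (Sum.inr k) (fun _ => a) (.goto fun _ => exit)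
  | pop k, _, exit, _ => .pop (Sum.inr k) (fun v _ => v) (.goto fun _ => exit)
  | seq p q, emb, exit, x =>
    Sum.casesOn (motive := fun _ => Turing.TM2.Stmt (Alphabet K A I) Λ (Option A)) x
      (fun y => compile p (fun z => emb (Sum.inl z)) (emb (Sum.inr (entry q))) y)
      (fun y => compile q (fun z => emb (Sum.inr z)) exit y)
  | switch k f, emb, exit, x =>
    Option.casesOn (motive := fun _ => Turing.TM2.Stmt (Alphabet K A I) Λ (Option A)) x
      (.peek (Sum.inr k) (fun _ y => y) (.goto fun y => emb (some ⟨y, entry (f y)⟩)))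
      (fun y => compile (f y.1) (fun z => emb (some ⟨y.1, z⟩)) exit y.2)
  | loop k c p, emb, exit, x =>
    Option.casesOn (motive := fun _ => Turing.TM2.Stmt (Alphabet K A I) Λ (Option A)) x
      (.peek (Sum.inr k) (fun _ y => y)
        (.goto fun y => if c y then emb (some (entry p)) else exit))
      (fun y => compile p (fun z => emb (some z)) (emb none) y)

/-- `MachineRun M T c c'`: the machine `M` gets from `c` to `c'` in at most `T` steps. -/
def MachineRun {J Λ σ : Type} [DecidableEq J] {Γ : J → Type}
    (M : Λ → Turing.TM2.Stmt Γ Λ σ) (T : ℕ) (c c' : Turing.TM2.Cfg Γ Λ σ) : Prop :=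
  ∃ t ≤ T, (flip bind (Turing.TM2.step M))^[t] (some c) = some c'

namespace MachineRun

variable {J Λ σ : Type} [DecidableEq J] {Γ : J → Type} {M : Λ → Turing.TM2.Stmt Γ Λ σ}
  {c₁ c₂ c₃ : Turing.TM2.Cfg Γ Λ σ} {t₁ t₂ : ℕ}

theorem trans (h₁ : MachineRun M t₁ c₁ c₂) (h₂ : MachineRun M t₂ c₂ c₃) :
    MachineRun M (t₁ + t₂) c₁ c₃ := by
  obtain ⟨t, ht, h⟩ := h₁
  obtain ⟨u, hu, h'⟩ := h₂
  refine ⟨u + t, by omega, ?_⟩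
  rw [Function.iterate_add_apply, h, h']

theorem single (h : Turing.TM2.step M c₁ = some c₂) : MachineRun M 1 c₁ c₂ :=
  ⟨1, le_rfl, h⟩

theorem mono (h : MachineRun M t₁ c₁ c₂) (ht : t₁ ≤ t₂) : MachineRun M t₂ c₁ c₂ :=
  let ⟨t, h₁, h₂⟩ := h
  ⟨t, h₁.trans ht, h₂⟩

end MachineRun

/-- Every instruction and every test of a `switch` or `loop` compiles to one machine step, and `seq`
costs nothing because the first part exits directly into the entry of the second. The internal state
`v` is arbitrary, since it is overwritten by each `peek` before being read. -/
theorem Exec.machineRun [DecidableEq K] {I Λ : Type} {p : StackProg K A} {S S' : K → List A}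
    {T : ℕ} (h : Exec p S T S') (emb : Pos p → Λ) (exit : Λ)
    (M : Λ → Turing.TM2.Stmt (Alphabet K A I) Λ (Option A))
    (hM : ∀ x, M (emb x) = compile p emb exit x) (v : Option A) :
    ∃ v', MachineRun M T ⟨some (emb (entry p)), v, store [] S⟩
      ⟨some exit, v', store [] S'⟩ := by
  induction h generalizing exit v with
  | skip S =>
    exact ⟨v, .single (by simp [hM, compile])⟩
  | push k a S =>
    refine ⟨v, .single ?_⟩
    rw [Turing.TM2.step, hM]
    simp only [compile, Turing.TM2.stepAux]
    rw [← update_store]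
    rfl
  | pop k S =>
    refine ⟨v, .single ?_⟩
    rw [Turing.TM2.step, hM]
    simp only [compile, Turing.TM2.stepAux]
    rw [← update_store]
    rfl
  | @seq p q S₁ S₂ S₃ t₁ t₂ h₁ h₂ ih₁ ih₂ =>
    obtain ⟨v₁, r₁⟩ := ih₁ (fun z => emb (Sum.inl z)) (emb (Sum.inr (entry q)))
      (fun x => hM (Sum.inl x)) v
    obtain ⟨v₂, r₂⟩ := ih₂ (fun z => emb (Sum.inr z)) exit (fun x => hM (Sum.inr x)) v₁
    exact ⟨v₂, r₁.trans r₂⟩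
  | @switch k f S S' t h ih =>
    obtain ⟨v₁, r₁⟩ := ih (fun z => emb (some ⟨(S k).head?, z⟩)) exit
      (fun x => hM (some ⟨(S k).head?, x⟩)) (S k).head?
    refine ⟨v₁, ((MachineRun.single ?_).trans r₁).mono (by omega)⟩
    rw [Turing.TM2.step, hM]
    rfl
  | @loop_end k c p S h =>
    refine ⟨(S k).head?, .single ?_⟩
    rw [Turing.TM2.step, hM]
    exact congrArg (fun l => some (Turing.TM2.Cfg.mk (some l) (S k).head? (store [] S)))
      (if_neg fun e => Bool.false_ne_true (h.symm.trans e))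
  | @loop_step k c p S₁ S₂ S₃ t₁ t₂ h h₁ h₂ ih₁ ih₂ =>
    obtain ⟨v₁, r₁⟩ := ih₁ (fun z => emb (some z)) (emb none)
      (fun x => hM (some x)) (S₁ k).head?
    obtain ⟨v₂, r₂⟩ := ih₂ emb exit hM v₁
    refine ⟨v₂, ((MachineRun.single ?_).trans (r₁.trans r₂)).mono (by omega)⟩
    rw [Turing.TM2.step, hM]
    exact congrArg (fun l => some (Turing.TM2.Cfg.mk (some l) (S₁ k).head? (store [] S₁)))
      (if_pos h)
  | mono _ ht ih =>
    obtain ⟨v₁, r₁⟩ := ih emb exit hM v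
    exact ⟨v₁, r₁.mono ht⟩

/-! ### The complete machine, with input and output. -/

/-- The statements of the machine for a program `p`: it first moves the input, translated by `tr`,
to the stack `kin`, then runs `p`, and finally outputs whether the stack `kout` is nonempty. -/
def machineStmt {I : Type} [Inhabited A] (p : StackProg K A) (tr : I → A) (kin kout : K) :
    Bool ⊕ Pos p → Turing.TM2.Stmt (Alphabet K A I) (Bool ⊕ Pos p) (Option A)
  | Sum.inl false =>
    .pop (Sum.inl false) (fun _ x => Option.map tr x)
      (.branch (fun v => v.isSome)
        (.push (Sum.inr kin) (fun v => v.getD default) (.goto fun _ => Sum.inl false))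
        (.goto fun _ => Sum.inr (entry p)))
  | Sum.inl true =>
    .pop (Sum.inr kout) (fun _ x => x)
      -- A `haltList` configuration has the initial internal state and no nonempty stack but the
      -- output, hence the reset to `none`. For the same reason programs have to clean up their
      -- stacks.
      (.push (Sum.inl true) (fun v => v.isSome) (.load (fun _ => none) .halt))
  | Sum.inr x => compile p Sum.inr (Sum.inl true) x

/-- The machine with the statements `machineStmt`. -/
noncomputable def machine {I : Type} [Fintype I] [DecidableEq K] [Fintype K] [Fintype A]
    [Inhabited A] (p : StackProg K A) (tr : I → A) (kin kout : K) : Turing.FinTM2 where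
  K := Bool ⊕ K
  k₀ := Sum.inl false
  k₁ := Sum.inl true
  Γ := Alphabet K A I
  Λ := Bool ⊕ Pos p
  main := Sum.inl false
  σ := Option A
  initialState := none
  Γk₀Fin := inferInstanceAs (Fintype I)
  m := machineStmt p tr kin kout

section Machine

variable {I : Type} [DecidableEq K] [Inhabited A] (p : StackProg K A) (tr : I → A) (kin kout : K)

/-- Moving a stack symbol by symbol reverses it, so the program receives its input reversed. The
extra step is the one that finds the input stack empty. -/
theorem machineRun_load (i : List I) (l : List A) (v : Option A) :
    MachineRun (machineStmt p tr kin kout) (i.length + 1)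
      ⟨some (Sum.inl false), v, store i (Function.update (fun _ => []) kin l)⟩
      ⟨some (Sum.inr (entry p)), none,
        store [] (Function.update (fun _ => []) kin ((i.map tr).reverse ++ l))⟩ := by
  induction i generalizing l v with
  | nil =>
    refine (MachineRun.single ?_).mono (by simp)
    exact congrArg (fun s => some (Turing.TM2.Cfg.mk (some (Sum.inr (entry p))) none s))
      (update_store_input [] [] _)
  | cons x i ih =>
    have := ih (tr x :: l) (some (tr x))
    rw [List.map_cons, List.reverse_cons, List.append_assoc]
    refine ((MachineRun.single ?_).trans this).mono (t₁ := 1 + (i.length + 1))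
      (by simp; omega)
    refine congrArg (fun s => some (Turing.TM2.Cfg.mk (some (Sum.inl false)) (some (tr x)) s)) ?_
    have h₁ := update_store_input (x :: i) i (Function.update (fun _ => []) kin l)
    have h₂ := update_store i (Function.update (fun _ => []) kin l) kin (tr x :: l)
    rw [Function.update_idem] at h₂
    rw [← h₂, ← h₁]
    congr 2
    exact (congrFun h₁ (Sum.inr kin)).trans
      (Function.update_self (β := fun _ => List A) kin l (fun _ => []))

theorem machineRun_output (S : K → List A) (v : Option A) :
    MachineRun (machineStmt (I := I) p tr kin kout) 1 ⟨some (Sum.inl true), v, store [] S⟩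
      ⟨none, none, Function.update (store [] (Function.update S kout (S kout).tail))
        (Sum.inl true) [(S kout).head?.isSome]⟩ := by
  refine .single ?_
  rw [← update_store]
  rfl

theorem machineRun_output_bool (b : Bool) (a : A) (v : Option A) :
    MachineRun (machineStmt (I := I) p tr kin kout) 1
      ⟨some (Sum.inl true), v,
        store [] (Function.update (fun _ => []) kout (if b then [a] else []))⟩
      ⟨none, none, Function.update (fun _ => []) (Sum.inl true) [b]⟩ := by
  have h := machineRun_output (I := I) p tr kin kout
    (Function.update (fun _ => []) kout (if b then [a] else [])) v
  have h₁ : (if b then [a] else []).head?.isSome = b := by cases b <;> rfl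
  have h₂ : (if b then [a] else []).tail = [] := by cases b <;> rfl
  have h₃ : store (A := A) (I := I) [] (fun _ : K => []) = fun _ => [] := by
    funext k
    rcases k with (_ | _) | k <;> rfl
  rwa [Function.update_self, Function.update_idem, h₁, h₂,
    Function.update_eq_self_iff.2 rfl, h₃] at h

end Machine

/-- A program that transforms the reversed input on the stack `kin` into the answer on the stack
`kout` yields a Turing machine that decides the problem. -/
theorem decidableInTime {α I : Type} [Fintype I] [DecidableEq K] [Fintype K] [Fintype A]
    [Inhabited A] {enc : α → List I} {L : Set α} {T T' : α → ℕ} (p : StackProg K A) (tr : I → A)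
    (kin kout : K) (a₀ : A)
    (h : ∀ a, ∃ b : Bool, (b = true ↔ a ∈ L) ∧
      Exec p (Function.update (fun _ => []) kin ((enc a).map tr).reverse) (T a)
        (Function.update (fun _ => []) kout (if b then [a₀] else [])))
    (hT : ∀ a, (enc a).length + T a + 2 ≤ T' a) :
    DecidableInTime enc L T' := by
  refine ⟨⟨machine p tr kin kout, Equiv.refl I, Equiv.refl Bool⟩, fun a => ?_⟩
  obtain ⟨b, hb, he⟩ := h a
  refine ⟨b, hb, ?_⟩
  obtain ⟨v, hv⟩ := he.machineRun (I := I) Sum.inr (Sum.inl true) (machineStmt p tr kin kout)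
    (fun _ => rfl) none
  have h₁ := machineRun_load p tr kin kout (enc a) [] none
  rw [List.append_nil, Function.update_eq_self] at h₁
  -- The `2` in `hT` is the step that notices the end of the input and the step that writes the
  -- answer.
  obtain ⟨t, ht, hr⟩ := (h₁.trans (hv.trans (machineRun_output_bool p tr kin kout b a₀ v))).mono
    (t₂ := T' a) (by have := hT a; omega)
  refine ⟨⟨⟨t, ?_⟩, ht⟩⟩
  have hi : Turing.initList (machine p tr kin kout) ((enc a).map (Equiv.refl I).symm) =
      ⟨some (Sum.inl false), none, store (enc a) (fun _ => [])⟩ := by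
    refine congrArg (Turing.TM2.Cfg.mk (some (Sum.inl false)) none) ?_
    funext k
    rcases k with (_ | _) | k
    · exact List.map_id _
    · rfl
    · rfl
  have ho : Turing.haltList (machine p tr kin kout) ([b].map (Equiv.refl Bool).symm) =
      ⟨none, none, Function.update (fun _ => []) (Sum.inl true) [b]⟩ := by
    refine congrArg (Turing.TM2.Cfg.mk none none) ?_
    funext k
    rcases k with (_ | _) | k <;> rfl
  refine Eq.trans ?_ (hr.trans (congrArg some ho.symm))
  exact congrArg (fun c => (flip bind (Turing.TM2.step (machineStmt p tr kin kout)))^[t] (some c))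
    hi

end StackProg

namespace StackProg

open Function (update)

variable {K A : Type}

/-! ### Basic programs -/

section Basic

variable [DecidableEq K]

theorem Exec.of_eq {p : StackProg K A} {S S₁ S₂ : K → List A} {T₁ T₂ : ℕ} (h : Exec p S T₁ S₁)
    (hS : S₁ = S₂) (hT : T₁ ≤ T₂) : Exec p S T₂ S₂ :=
  hS ▸ h.mono hT

theorem exec_switch_nil {k : K} {f : Option A → StackProg K A} {S S' : K → List A} {T : ℕ}
    (hk : S k = []) (h : Exec (f none) S T S') : Exec (switch k f) S (T + 1) S' :=
  .switch (by rwa [hk])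

theorem exec_switch_cons {k : K} {f : Option A → StackProg K A} {S S' : K → List A} {T : ℕ}
    {a : A} {l : List A} (hk : S k = a :: l) (h : Exec (f (some a)) S T S') :
    Exec (switch k f) S (T + 1) S' :=
  .switch (by rwa [hk])

theorem exec_pop_cons {k : K} {S : K → List A} {a : A} {l : List A} (hk : S k = a :: l) :
    Exec (pop k) S 1 (update S k l) :=
  (Exec.pop k S).of_eq (by rw [hk]; rfl) le_rfl

/-- Remove all elements of a stack. -/
def clear (a : K) : StackProg K A := loop a Option.isSome (pop a)

theorem exec_clear (a : K) (S : K → List A) :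
    Exec (clear a) S (2 * (S a).length + 1) (update S a []) := by
  generalize h : S a = l
  induction l generalizing S with
  | nil => exact Exec.of_eq (Exec.loop_end (by simp [h])) (by simp [← h]) (by simp)
  | cons x l ih =>
    refine Exec.of_eq (Exec.loop_step (by simp [h]) (exec_pop_cons h) (ih (update S a l) (by simp)))
      (by simp) ?_
    simp; omega

/-- Move the top of stack `a` to stack `b`, translated by `g`, as long as it satisfies `c`. -/
def moveWhile (a b : K) (c : Option A → Bool) (g : A → A) : StackProg K A :=
  loop a c (switch a fun
    | none => skip
    | some x => pop a ;; push b (g x))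

/-- Four steps per symbol: loop test, `switch`, `pop`, `push`. -/
theorem exec_moveWhile {a b : K} (hab : a ≠ b) {c : Option A → Bool} {g : A → A} {l r : List A}
    (hl : ∀ x ∈ l, c (some x) = true) (hr : c r.head? = false) {S : K → List A}
    (hS : S a = l ++ r) :
    Exec (moveWhile a b c g) S (4 * l.length + 1)
      (update (update S a r) b ((l.map g).reverse ++ S b)) := by
  induction l generalizing S with
  | nil =>
    refine Exec.of_eq (Exec.loop_end (by simp_all)) ?_ (by simp)
    simp [← show S a = r from hS]
  | cons x l ih =>
    refine Exec.of_eq (Exec.loop_step (t₁ := 3)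
      (S₂ := update (update S a (l ++ r)) b (g x :: S b))
      (by simp_all) ?_ (ih (by simp_all) (by simp [hab]))) ?_ ?_
    · exact exec_switch_cons hS (Exec.of_eq (Exec.seq (exec_pop_cons hS) (Exec.push b (g x) _))
        (by simp [hab.symm]) le_rfl)
    · rw [Function.update_comm hab.symm, Function.update_idem]
      simp
    · simp; omega

/-- Move all elements of stack `a` to stack `b`. -/
def move (a b : K) : StackProg K A := moveWhile a b Option.isSome id

theorem exec_move {a b : K} (hab : a ≠ b) (S : K → List A) :
    Exec (move a b) S (4 * (S a).length + 1)
      (update (update S a []) b ((S a).reverse ++ S b)) := by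
  have := exec_moveWhile hab (c := Option.isSome) (g := id) (l := S a) (r := [])
    (by simp) (by simp) (S := S) (by simp)
  simpa [move] using this

variable [DecidableEq A]

/-- Copy the elements of stack `a` above the first `t` to the stacks `b` and `d`, removing them
from `a`. -/
def copyUntil (a b d : K) (t : A) : StackProg K A :=
  loop a (fun x => decide (x ≠ some t)) (switch a fun
    | none => skip
    | some x => pop a ;; push b x ;; push d x)

theorem exec_copyUntil {a b d : K} (hab : a ≠ b) (had : a ≠ d) (hbd : b ≠ d) {t : A}
    {l r : List A} (hl : t ∉ l) {S : K → List A} (hS : S a = l ++ t :: r) :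
    Exec (copyUntil a b d t) S (5 * l.length + 1)
      (update (update (update S a (t :: r)) b (l.reverse ++ S b)) d (l.reverse ++ S d)) := by
  induction l generalizing S with
  | nil =>
    refine Exec.of_eq (Exec.loop_end (by simp_all)) ?_ (by simp)
    simp [← show S a = t :: r from hS]
  | cons x l ih =>
    simp only [List.mem_cons, not_or] at hl
    refine Exec.of_eq (Exec.loop_step (t₁ := 4)
      (S₂ := update (update (update S a (l ++ t :: r)) b (x :: S b)) d (x :: S d))
      (by simp [hS, Ne.symm hl.1]) ?_ (ih hl.2 (by simp [hab, had]))) ?_ ?_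
    · exact exec_switch_cons hS (Exec.of_eq
        (Exec.seq (exec_pop_cons hS) (Exec.seq (Exec.push b x _) (Exec.push d x _)))
        (by simp [hab.symm, had.symm, hbd.symm]) le_rfl)
    · funext k
      simp only [Function.update_apply]
      split_ifs <;> simp_all
    · simp; omega

end Basic

/-! ### Counting down binary numbers -/

/-- The symbols on the stacks of the program for Hidden-ID. -/
inductive Token
  | bit (b : Bool)
  | comma
  | bar
  | semi
  deriving DecidableEq, Fintype

instance : Inhabited Token := ⟨.semi⟩

/-- The value of a binary number, least significant digit first. -/
def binValue : List Bool → ℕ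
  | [] => 0
  | b :: l => b.toNat + 2 * binValue l

theorem binValue_bits (n : ℕ) : binValue n.bits = n := by
  induction n using Nat.binaryRec' with
  | zero => simp [binValue]
  | bit b n h ih =>
    rw [Nat.bits_append_bit n b h, binValue, ih, Nat.bit_val]
    omega

theorem binValue_replicate_false (k : ℕ) (l : List Bool) :
    binValue (List.replicate k false ++ l) = 2 ^ k * binValue l := by
  induction k with
  | zero => simp
  | succ k ih =>
    rw [List.replicate_succ, List.cons_append, binValue, ih, pow_succ]
    simp; ring

/-- Borrowing, least significant digit first: `2 ^ k - 1` has `k` digits one. -/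
theorem binValue_pred (k : ℕ) (l : List Bool) :
    binValue (List.replicate k true ++ false :: l) + 1 =
      binValue (List.replicate k false ++ true :: l) := by
  induction k with
  | zero => simp [binValue]; omega
  | succ k ih =>
    simp only [List.replicate_succ, List.cons_append, binValue]
    simp; omega

theorem exists_leading_false (l : List Bool) : ∃ k r, l = List.replicate k false ++ r ∧
    (r = [] ∨ ∃ r', r = true :: r') := by
  induction l with
  | nil => exact ⟨0, [], by simp⟩
  | cons b l ih =>
    cases b with
    | true => exact ⟨0, true :: l, by simp⟩
    | false =>
      obtain ⟨k, r, h, hr⟩ := ih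
      exact ⟨k + 1, r, by simp [h, List.replicate_succ], hr⟩

/-- Decrement the binary number on the stack `num`, and push a symbol to the stack `un` if it was
positive. -/
def countdown (num aux un : K) : StackProg K Token :=
  moveWhile num aux (fun x => decide (x = some (.bit false))) (fun _ => .bit true) ;;
  switch num fun
    | none => clear aux
    | some _ => pop num ;; push num (.bit false) ;; move aux num ;; push un .semi

variable [DecidableEq K]

/-- The leading zeros go to `aux` as ones. If a one follows, it becomes zero and the ones return, as
in `binValue_pred`; otherwise the number was zero and `aux` is discarded. The difference of the
values is thus 0 or 1. The bound on the length of `l'` keeps the cost stable under repetition. -/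
theorem exec_countdown {num aux un : K} (h₁ : num ≠ aux) (h₂ : num ≠ un) (h₃ : aux ≠ un)
    {S : K → List Token} (l : List Bool) (hl : S num = l.map .bit) (ha : S aux = []) :
    ∃ l' : List Bool, l'.length ≤ l.length ∧ binValue l' = binValue l - 1 ∧
      Exec (countdown num aux un) S (8 * l.length + 6) (update (update S num (l'.map .bit)) un
        (List.replicate (binValue l - binValue l') .semi ++ S un)) := by
  obtain ⟨k, r, rfl, hr⟩ := exists_leading_false l
  rw [List.map_append] at hl
  have hm := exec_moveWhile h₁ (c := fun x => decide (x = some (.bit false)))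
    (g := fun _ => Token.bit true) (l := (List.replicate k false).map .bit) (r := r.map Token.bit)
    (by simp) (by rcases hr with rfl | ⟨r', rfl⟩ <;> simp) hl
  rcases hr with rfl | ⟨r, rfl⟩
  · refine ⟨[], by simp, by rw [binValue_replicate_false]; simp [binValue], ?_⟩
    refine Exec.of_eq (Exec.seq hm (exec_switch_nil (by simp [h₁]) (exec_clear aux _))) ?_ ?_
    · funext j
      have : binValue (List.replicate k false) = 0 := by
        simpa [binValue] using binValue_replicate_false k []
      simp only [Function.update_apply]
      split_ifs <;> simp_all [binValue]
    · simp [ha]; omega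
  · have hv := binValue_pred k r
    refine ⟨List.replicate k true ++ false :: r, by simp, by omega, ?_⟩
    refine Exec.of_eq (Exec.seq hm (exec_switch_cons (a := .bit true) (l := r.map Token.bit) (by simp [h₁])
      (Exec.seq (exec_pop_cons (a := .bit true) (l := r.map Token.bit) (by simp [h₁])) (Exec.seq (Exec.push ..)
        (Exec.seq (exec_move h₁.symm _) (Exec.push ..)))))) ?_ ?_
    · have : binValue (List.replicate k false ++ true :: r) -
          binValue (List.replicate k true ++ false :: r) = 1 := by omega
      rw [this]
      funext j
      simp only [Function.update_apply]
      split_ifs <;> simp_all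
    · simp [h₁.symm, ha]; omega

/-- Move all elements of stack `a` to stack `b`, counting the symbols `t` in the sense that the
number on stack `num` is decremented for each of them. -/
def moveCount (a b num aux un : K) (t : Token) : StackProg K Token :=
  loop a Option.isSome (switch a fun
    | none => skip
    | some x => pop a ;; push b x ;; if x = t then countdown num aux un else skip)

/-- With `n` the initial number and `k` the number of symbols `t`, the stack `un` receives `min n k`
symbols and `num` keeps the truncated difference `n - k`, which is positive iff `n > k`. This
converts to unary without exceeding the size of the input. -/
theorem exec_moveCount {a b num aux un : K} (hn : [a, b, num, aux, un].Nodup) (t : Token)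
    {S : K → List Token} (l : List Token) (bs : List Bool) (hl : S a = l)
    (hb : S num = bs.map .bit) (ha : S aux = []) :
    ∃ bs' : List Bool, bs'.length ≤ bs.length ∧ binValue bs' = binValue bs - l.count t ∧
      Exec (moveCount a b num aux un t) S (l.length * (8 * bs.length + 10) + 1)
        (update (update (update (update S a []) b (l.reverse ++ S b)) num (bs'.map .bit)) un
          (List.replicate (binValue bs - binValue bs') .semi ++ S un)) := by
  simp only [List.nodup_cons, List.mem_cons, List.not_mem_nil, or_false, not_or, not_false_eq_true,
    List.nodup_nil, and_true] at hn
  obtain ⟨⟨n1, n2, n3, n4⟩, ⟨n5, n6, n7⟩, ⟨n8, n9⟩, n10⟩ := hn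
  induction l generalizing S bs with
  | nil =>
    refine ⟨bs, le_rfl, by simp, Exec.of_eq (Exec.loop_end (by simp [hl])) ?_ (by simp)⟩
    funext j
    simp only [Function.update_apply]
    split_ifs <;> simp_all
  | cons x l ih =>
    set S₁ := update (update S a l) b (x :: S b) with hS₁
    obtain ⟨b₁, hb₁, hv₁, he₁⟩ : ∃ b₁ : List Bool, b₁.length ≤ bs.length ∧
        binValue b₁ = binValue bs - (if x = t then 1 else 0) ∧
        Exec (if x = t then countdown num aux un else skip) S₁ (8 * bs.length + 6)
          (update (update S₁ num (b₁.map .bit)) un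
            (List.replicate (binValue bs - binValue b₁) .semi ++ S₁ un)) := by
      split_ifs with hx
      · exact exec_countdown n8 n9 n10 bs (by simp [*, Ne.symm n2, Ne.symm n5])
          (by simp [*, Ne.symm n3, Ne.symm n6])
      · refine ⟨bs, le_rfl, by simp, Exec.of_eq (Exec.skip S₁) ?_ (by omega)⟩
        funext j
        simp only [hS₁, Function.update_apply]
        split_ifs <;> simp_all
    obtain ⟨b₂, hb₂, hv₂, he₂⟩ := ih b₁
      (S := update (update S₁ num (b₁.map .bit)) un
            (List.replicate (binValue bs - binValue b₁) .semi ++ S₁ un))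
      (by simp [hS₁, n1, n2, n4]) (by simp [n9])
      (by simp [hS₁, n10, ha, Ne.symm n8, Ne.symm n3, Ne.symm n6])
    have hcount : (x :: l).count t = l.count t + if x = t then 1 else 0 := by
      rw [List.count_cons]; simp
    refine ⟨b₂, hb₂.trans hb₁, by omega, ?_⟩
    have hp : Exec (push b x) (update S a l) 1 S₁ :=
      Exec.of_eq (Exec.push ..) (by simp [hS₁, Ne.symm n1]) le_rfl
    refine Exec.of_eq (Exec.loop_step (by simp [hl]) (exec_switch_cons hl
      (Exec.seq (exec_pop_cons hl) (Exec.seq hp he₁))) he₂) ?_ ?_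
    · have hr : binValue bs - binValue b₂ =
          (binValue b₁ - binValue b₂) + (binValue bs - binValue b₁) := by omega
      rw [hr]
      clear he₁ he₂ hr hv₁ hv₂ hcount hp ih hl hb ha
      funext j
      simp only [hS₁, Function.update_apply]
      split_ifs <;> try simp_all
      rw [List.replicate_add, List.append_assoc]
    · have := Nat.mul_le_mul_left l.length (show 8 * b₁.length + 10 ≤ 8 * bs.length + 10 by omega)
      simp only [List.length_cons, add_mul]
      omega

end StackProg

namespace StackProg

open Function (update)

/-! ### The program for Hidden-ID: one pass over the list of rankings -/

/-- The stacks of the program for Hidden-ID. -/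
inductive Reg
  | buf | lev | cand | candDone | numC | numV | cntC | cntV | aux | rej | word | pre | mis | new
  | res
  deriving DecidableEq

instance : Fintype Reg :=
  ⟨{.buf, .lev, .cand, .candDone, .numC, .numV, .cntC, .cntV, .aux, .rej, .word, .pre, .mis, .new,
    .res}, fun k => by cases k <;> decide⟩

/-- A word over bits, ended by a comma. -/
def encWord (w : List Bool) : List Token := w.map .bit ++ [.comma]

/-- A list of words, ended by a bar. -/
def encRanking (r : List (List Bool)) : List Token := r.flatMap encWord ++ [.bar]

/-- A list of rankings, ended by `semi`. -/
def encState (s : List (List (List Bool))) : List Token := s.flatMap encRanking ++ [.semi]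

/-- A list of lists of rankings. -/
def encLevel (l : List (List (List (List Bool)))) : List Token := l.flatMap encState

/-- The part of a list after the first occurrence of `c`, if there is one. -/
def dropThrough {α : Type*} [DecidableEq α] (c : α) : List α → Option (List α)
  | [] => none
  | w :: r => if w = c then some r else dropThrough c r

/-- Compare the word on top of the stack `lev` with the word on the stack `word`. -/
def compareWord : StackProg Reg Token :=
  loop .lev (fun x => decide (x ≠ some .comma)) (switch .lev fun
    | none => skip
    | some x => pop .lev ;; push .buf x ;; switch .word fun y =>
        if y = some x then pop .word ;; push .pre x else push .mis x)

/-- The loop does not stop at a mismatch but records it on `mis` and runs on to the comma. Letters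
that match afterwards may still go from `word` to `pre`; this is harmless, since `mis` stays
nonempty. The equation between `p'`, `c'` and `p`, `c` is the invariant that allows `word` to be
restored. -/
theorem exec_compareWord {rest : List Token} (w c p : List Bool) {S : Reg → List Token}
    (hl : S .lev = w.map .bit ++ .comma :: rest) (hw : S .word = c.map .bit)
    (hp : S .pre = p.map .bit) :
    ∃ (c' p' : List Bool) (e : List Token), p'.reverse ++ c' = p.reverse ++ c ∧
      (c' = [] ∧ e = [] ↔ S .mis = [] ∧ w = c) ∧ e.length ≤ (S .mis).length + w.length ∧
      Exec compareWord S (7 * w.length + 1)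
        (update (update (update (update (update S .lev (.comma :: rest)) .buf
          ((w.map .bit).reverse ++ S .buf)) .word (c'.map .bit)) .pre (p'.map .bit)) .mis e) := by
  induction w generalizing c p S with
  | nil =>
    refine ⟨c, p, S .mis, rfl, by tauto, by simp, Exec.of_eq (Exec.loop_end (by simp_all)) ?_
      (by simp)⟩
    funext k
    cases k <;> simp_all
  | cons x w ih =>
    by_cases hc : ∃ c₁, c = x :: c₁
    · obtain ⟨c, rfl⟩ := hc
      obtain ⟨c', p', e, h₁, h₂, h₃, h₄⟩ := ih c (x :: p)
        (S := update (update (update (update S .lev (w.map .bit ++ .comma :: rest)) .buf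
          (.bit x :: S .buf)) .word (c.map .bit)) .pre (.bit x :: S .pre))
        (by simp) (by simp) (by simp [hp])
      refine ⟨c', p', e, by simpa using h₁, by simpa using h₂, by simp at h₃ ⊢; omega, ?_⟩
      have hs : ∀ S₁ : Reg → List Token, S₁ .word = .bit x :: c.map .bit →
          Exec (switch .word fun y => if y = some (.bit x) then pop .word ;; push .pre (.bit x)
            else push .mis (.bit x)) S₁ 3
            (update (update S₁ .word (c.map .bit)) .pre (.bit x :: S₁ .pre)) := fun S₁ h =>
        exec_switch_cons h (by
          rw [if_pos rfl]
          exact Exec.of_eq (Exec.seq (exec_pop_cons h) (Exec.push ..)) (by simp) le_rfl)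
      refine Exec.of_eq (Exec.loop_step (t₁ := 6) (by simp [hl]) (exec_switch_cons hl
        (Exec.of_eq (Exec.seq (exec_pop_cons hl) (Exec.seq (Exec.push ..)
          (hs _ (by simp [hw])))) ?_ le_rfl)) h₄) ?_ ?_
      · funext k
        cases k <;> simp
      · funext k
        cases k <;> simp
      · simp; omega
    · obtain ⟨c', p', e, h₁, h₂, h₃, h₄⟩ := ih c p
        (S := update (update (update S .lev (w.map .bit ++ .comma :: rest)) .buf
          (.bit x :: S .buf)) .mis (.bit x :: S .mis))
        (by simp) (by simp [hw]) (by simp [hp])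
      refine ⟨c', p', e, h₁, ?_, by simp at h₃ ⊢; omega, ?_⟩
      · rw [h₂]
        simp only [Function.update_self, reduceCtorEq, false_and, false_iff, not_and]
        rintro - rfl
        exact hc ⟨w, rfl⟩
      have hif : ¬ (S .word).head? = some (.bit x) := by
        rw [hw]
        cases c with
        | nil => simp
        | cons y c =>
          simp only [List.map_cons, List.head?_cons, Option.some.injEq, Token.bit.injEq]
          rintro rfl
          exact hc ⟨c, rfl⟩
      have hs : ∀ S₁ : Reg → List Token, S₁ .word = S .word →
          Exec (switch .word fun y => if y = some (.bit x) then pop .word ;; push .pre (.bit x)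
            else push .mis (.bit x)) S₁ 2 (update S₁ .mis (.bit x :: S₁ .mis)) := fun S₁ h =>
        Exec.switch (by
          rw [if_neg (by rwa [h])]
          exact Exec.push ..)
      refine Exec.of_eq (Exec.loop_step (t₁ := 5) (by simp [hl]) (exec_switch_cons hl
        (Exec.of_eq (Exec.seq (exec_pop_cons hl) (Exec.seq (Exec.push ..)
          (hs _ (by simp)))) ?_ le_rfl)) h₄) ?_ ?_
      · funext k
        cases k <;> simp
      · funext k
        cases k <;> simp
      · simp; omega

end StackProg

namespace StackProg

open Function (update)

/-- Undo the changes of `compareWord` to the stacks `word`, `pre` and `mis`. -/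
def restoreWord : StackProg Reg Token := clear .mis ;; move .pre .word

theorem exec_restoreWord (S : Reg → List Token) :
    Exec restoreWord S (2 * (S .mis).length + 4 * (S .pre).length + 2)
      (update (update (update S .mis []) .pre []) .word ((S .pre).reverse ++ S .word)) := by
  refine Exec.of_eq (Exec.seq (exec_clear ..) (exec_move (by decide) _)) ?_ ?_
  · funext k
    cases k <;> simp
  · simp; omega

/-- Compare the word on top of the stack `lev` with the word on the stack `word`; if they are
equal, copy the remaining ranking to the stack `new`. -/
def processWord : StackProg Reg Token :=
  compareWord ;; pop .lev ;; push .buf .comma ;; switch .mis fun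
    | some _ => restoreWord
    | none => switch .word fun
      | some _ => restoreWord
      | none => restoreWord ;; copyUntil .lev .buf .new .bar ;; pop .lev ;; push .buf .bar ;;
          push .new .bar

/-- Unequal words leave a symbol on `mis` or, if `w` is a proper prefix of `c`, on `word`. -/
theorem exec_processWord_ne {rest : List Token} {w c : List Bool} (hwc : w ≠ c)
    {S : Reg → List Token} (hl : S .lev = encWord w ++ rest) (hw : S .word = c.map .bit)
    (hp : S .pre = []) (hm : S .mis = []) :
    Exec processWord S (9 * w.length + 4 * c.length + 7)
      (update (update S .lev rest) .buf ((encWord w).reverse ++ S .buf)) := by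
  obtain ⟨c', p, e, h₁, h₂, h₃, h₄⟩ := exec_compareWord (rest := rest) w c [] (S := S)
    (by simp [hl, encWord]) hw (by simp [hp])
  have hc : p.length + c'.length = c.length := by simpa using congrArg List.length h₁
  set S₁ : Reg → List Token := update (update (update (update (update S .lev rest) .buf
    ((encWord w).reverse ++ S .buf)) .word (c'.map .bit)) .pre (p.map .bit)) .mis e with hS₁
  have hr : Exec restoreWord S₁ (2 * w.length + 4 * c.length + 2)
      (update (update S .lev rest) .buf ((encWord w).reverse ++ S .buf)) := by
    refine Exec.of_eq (exec_restoreWord S₁) ?_ ?_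
    · have : (p.map Token.bit).reverse ++ c'.map .bit = c.map .bit := by
        rw [← List.map_reverse, ← List.map_append, h₁]; rfl
      funext k
      cases k <;> simp_all
    · simp [hS₁] at h₃ ⊢
      rw [hm] at h₃
      simp at h₃
      omega
  have hsw : Exec (switch .mis fun
    | some _ => restoreWord
    | none => switch .word fun
      | some _ => restoreWord
      | none => restoreWord ;; copyUntil .lev .buf .new .bar ;; pop .lev ;; push .buf .bar ;;
          push .new .bar) S₁ (2 * w.length + 4 * c.length + 4)
      (update (update S .lev rest) .buf ((encWord w).reverse ++ S .buf)) := by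
    cases e with
    | cons a e => exact (exec_switch_cons (a := a) (l := e) (by simp [hS₁]) hr).mono (by omega)
    | nil =>
      cases c' with
      | nil => exact absurd (h₂.1 ⟨rfl, rfl⟩).2 hwc
      | cons b c' =>
        exact exec_switch_nil (by simp [hS₁])
          (exec_switch_cons (a := .bit b) (l := c'.map .bit) (by simp [hS₁]) hr)
  have hpush : Exec (push .buf .comma) (update (update (update (update (update S .lev rest) .buf
      ((w.map .bit).reverse ++ S .buf)) .word (c'.map .bit)) .pre (p.map .bit)) .mis e) 1 S₁ := by
    refine Exec.of_eq (Exec.push ..) ?_ le_rfl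
    funext k
    cases k <;> simp [hS₁, encWord]
  have hpop : Exec (pop .lev) (update (update (update (update (update S .lev (.comma :: rest)) .buf
      ((w.map .bit).reverse ++ S .buf)) .word (c'.map .bit)) .pre (p.map .bit)) .mis e) 1
      (update (update (update (update (update S .lev rest) .buf
      ((w.map .bit).reverse ++ S .buf)) .word (c'.map .bit)) .pre (p.map .bit)) .mis e) := by
    refine Exec.of_eq (Exec.pop ..) ?_ le_rfl
    funext k
    cases k <;> simp
  exact Exec.of_eq (Exec.seq h₄ (Exec.seq hpop (Exec.seq hpush hsw))) rfl (by omega)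

/-- As `r` contains no bar, the copy stops exactly at the end of the current ranking. -/
theorem exec_processWord_eq {rest r : List Token} {c : List Bool} (hr : Token.bar ∉ r)
    {S : Reg → List Token} (hl : S .lev = encWord c ++ (r ++ .bar :: rest))
    (hw : S .word = c.map .bit) (hp : S .pre = []) (hm : S .mis = []) :
    Exec processWord S (13 * c.length + 5 * r.length + 11)
      (update (update (update S .lev rest) .buf
        ((encWord c ++ (r ++ [Token.bar])).reverse ++ S .buf)) .new
          ((r ++ [Token.bar]).reverse ++ S .new)) := by
  obtain ⟨c', p, e, h₁, h₂, h₃, h₄⟩ := exec_compareWord (rest := r ++ .bar :: rest) c c [] (S := S)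
    (by simp [hl, encWord]) hw (by simp [hp])
  obtain ⟨rfl, rfl⟩ := h₂.2 ⟨hm, rfl⟩
  have hpc : p.reverse = c := by simpa using h₁
  have hc : p.length = c.length := by simp [← hpc]
  refine Exec.of_eq (Exec.seq h₄ (Exec.seq
    (exec_pop_cons (a := .comma) (l := r ++ .bar :: rest) (by simp)) (Exec.seq (Exec.push ..)
      (exec_switch_nil (by simp) (exec_switch_nil (by simp) (Exec.seq (exec_restoreWord _)
        (Exec.seq (exec_copyUntil (r := rest) (by decide) (by decide) (by decide) hr (by simp))
          (Exec.seq (exec_pop_cons (a := .bar) (l := rest) (by simp))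
            (Exec.seq (Exec.push ..) (Exec.push ..)))))))))) ?_ ?_
  · have : (p.map Token.bit).reverse = c.map .bit := by
      rw [← List.map_reverse, hpc]
    clear h₄
    funext k
    cases k <;> simp [encWord, this, hp, hm, hw]
  · simp
    omega

/-- Remove from every ranking on the stack `lev` everything up to the word on the stack `word`,
and put the resulting rankings on the stack `new` in reversed order; rankings without this word are
dropped. The content of the stack `lev` is moved to the stack `buf`. -/
def passLoop : StackProg Reg Token :=
  loop .lev Option.isSome (switch .lev fun
    | some Token.semi => pop .lev ;; push .buf .semi ;; push .new .semi
    | some Token.bar => pop .lev ;; push .buf .bar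
    | _ => processWord)

/-- The effect of processing the string `i` in `passLoop`, if the output is `o`. -/
def passResult (S : Reg → List Token) (rest i o : List Token) : Reg → List Token :=
  update (update (update S .lev rest) .buf (i.reverse ++ S .buf)) .new (o.reverse ++ S .new)

theorem passResult_passResult (S : Reg → List Token) (rest rest' i i' o o' : List Token) :
    passResult (passResult S rest i o) rest' i' o' = passResult S rest' (i ++ i') (o ++ o') := by
  funext k
  cases k <;> simp [passResult]

theorem bar_notMem_flatMap_encWord (r : List (List Bool)) :
    Token.bar ∉ r.flatMap encWord := by
  simp [encWord]

/-- `passLoop` is one flat loop over the symbols, not a nest of loops over states and rankings.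
Hence the continuation form: iterations for one ranking are put in front of a given run `h` on the
rest. The same form serves for states. -/
theorem exec_passLoop_ranking (c : List Bool) (r : List (List Bool)) {rest : List Token}
    {S S' : Reg → List Token} {T : ℕ} (hl : S .lev = encRanking r ++ rest)
    (hw : S .word = c.map .bit) (hp : S .pre = []) (hm : S .mis = [])
    (h : Exec passLoop (passResult S rest (encRanking r)
      (((dropThrough c r).map encRanking).getD [])) T S') :
    Exec passLoop S (T + 20 * ((encRanking r).length * (c.length + 1))) S' := by
  induction r generalizing S with
  | nil =>
    have hl' : S .lev = .bar :: rest := by simpa [encRanking] using hl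
    -- The loop itself meets a bar only if `c` has not occurred in this ranking; nothing is written
    -- to `new`, so the ranking is dropped.
    refine Exec.of_eq (Exec.loop_step (by simp [hl']) (exec_switch_cons hl'
      (Exec.of_eq (Exec.seq (exec_pop_cons hl') (Exec.push ..)) ?_ le_rfl)) h) rfl ?_
    · funext k
      cases k <;> simp [passResult, encRanking, dropThrough]
    · simp [encRanking]; omega
  | cons w r ih =>
    have hl' : S .lev = encWord w ++ (encRanking r ++ rest) := by
      simpa [encRanking] using hl
    have hhead : ∀ (p₁ p₂ : StackProg Reg Token) (t : ℕ) (S₁ : Reg → List Token),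
        Exec processWord S t S₁ → Exec (switch .lev fun
          | some Token.semi => p₁
          | some Token.bar => p₂
          | _ => processWord) S (t + 1) S₁ := by
      intro p₁ p₂ t S₁ h'
      cases w with
      | nil => exact exec_switch_cons (a := .comma) (by rw [hl']; rfl) h'
      | cons b w => exact exec_switch_cons (a := .bit b) (by rw [hl']; rfl) h'
    have hsome : (S .lev).head?.isSome = true := by
      rw [hl']
      cases w <;> rfl
    have hlen : (encRanking (w :: r)).length = w.length + 1 + (encRanking r).length := by
      simp [encRanking, encWord]; omega
    by_cases hwc : w = c
    · subst hwc
      have hpw := exec_processWord_eq (rest := rest) (bar_notMem_flatMap_encWord r)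
        (by simpa [encRanking] using hl') hw hp hm
      refine Exec.of_eq (Exec.loop_step hsome (hhead _ _ _ _ (Exec.of_eq hpw ?_ le_rfl)) h) rfl ?_
      · funext k
        cases k <;> simp [passResult, encRanking, dropThrough]
      · have := Nat.le_mul_of_pos_right (encRanking (w :: r)).length 
          (show 0 < w.length + 1 by omega)
        have : (encRanking r).length = (r.flatMap encWord).length + 1 := by simp [encRanking]
        omega
    · have hpw := exec_processWord_ne hwc hl' hw hp hm
      have hres : passResult S rest (encRanking (w :: r))
            (((dropThrough c (w :: r)).map encRanking).getD []) =
          passResult (update (update S .lev (encRanking r ++ rest)) .buf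
            ((encWord w).reverse ++ S .buf)) rest (encRanking r)
            (((dropThrough c r).map encRanking).getD []) := by
        funext k
        cases k <;> simp [passResult, encRanking, dropThrough, hwc]
      rw [hres] at h
      refine Exec.of_eq (Exec.loop_step hsome (hhead _ _ _ _ hpw) (ih (by simp) (by simp [hw])
        (by simp [hp]) (by simp [hm]) h)) rfl ?_
      have : (w.length + 1 + (encRanking r).length) * (c.length + 1) =
        (encRanking r).length * (c.length + 1) + w.length * c.length + w.length + c.length + 1 := by
        ring
      rw [hlen, this]
      omega

/-- The rankings of a list after deleting everything up to `c`, where rankings without `c` are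
dropped. -/
def passState {α : Type*} [DecidableEq α] (c : α) (s : List (List α)) : List (List α) :=
  s.filterMap (dropThrough c)

theorem exec_passLoop_state (c : List Bool) (s : List (List (List Bool))) {rest : List Token}
    {S S' : Reg → List Token} {T : ℕ} (hl : S .lev = encState s ++ rest)
    (hw : S .word = c.map .bit) (hp : S .pre = []) (hm : S .mis = [])
    (h : Exec passLoop (passResult S rest (encState s) (encState (passState c s))) T S') :
    Exec passLoop S (T + 20 * ((encState s).length * (c.length + 1))) S' := by
  induction s generalizing S with
  | nil =>
    have hl' : S .lev = .semi :: rest := by simpa [encState] using hl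
    refine Exec.of_eq (Exec.loop_step (by simp [hl']) (exec_switch_cons hl'
      (Exec.of_eq (Exec.seq (exec_pop_cons hl') (Exec.seq (Exec.push ..) (Exec.push ..)))
        ?_ le_rfl)) h) rfl ?_
    · funext k
      cases k <;> simp [passResult, encState, passState]
    · simp [encState]; omega
  | cons r s ih =>
    have hlen : (encState (r :: s)).length = (encRanking r).length + (encState s).length := by
      simp [encState]
    have hout : encState (passState c (r :: s)) =
        ((dropThrough c r).map encRanking).getD [] ++ encState (passState c s) := by
      cases hd : dropThrough c r <;> simp [encState, passState, hd]
    have := exec_passLoop_ranking c r (rest := encState s ++ rest) (by simpa [encState] using hl)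
      hw hp hm (ih (S := passResult S (encState s ++ rest) (encRanking r)
        (((dropThrough c r).map encRanking).getD [])) (by simp [passResult])
        (by simp [passResult, hw]) (by simp [passResult, hp]) (by simp [passResult, hm]) (by
          rw [passResult_passResult, ← hout]
          have : encRanking r ++ encState s = encState (r :: s) := by simp [encState]
          rwa [this]))
    refine this.mono ?_
    rw [hlen, add_mul]
    omega

theorem exec_passLoop (c : List Bool) (l : List (List (List (List Bool))))
    {S : Reg → List Token} (hl : S .lev = encLevel l)
    (hw : S .word = c.map .bit) (hp : S .pre = []) (hm : S .mis = []) :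
    Exec passLoop S (20 * ((encLevel l).length * (c.length + 1)) + 1)
      (passResult S [] (encLevel l) (encLevel (l.map (passState c)))) := by
  induction l generalizing S with
  | nil =>
    have hl' : S .lev = [] := by simpa [encLevel] using hl
    refine Exec.of_eq (Exec.loop_end (by simp [hl'])) ?_ (by simp)
    funext k
    cases k <;> simp [passResult, encLevel, hl']
  | cons s l ih =>
    have h := ih (S := passResult S (encLevel l) (encState s) (encState (passState c s)))
      (by simp [passResult]) (by simp [passResult, hw]) (by simp [passResult, hp])
      (by simp [passResult, hm])
    rw [passResult_passResult] at h
    have := exec_passLoop_state c s (rest := encLevel l) (by simpa [encLevel] using hl) hw hp hm h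
    refine Exec.of_eq this rfl ?_
    have hlen : (encLevel (s :: l)).length = (encState s).length + (encLevel l).length := by
      simp [encLevel]
    rw [hlen, add_mul]
    omega

end StackProg

namespace StackProg

open Function (update)

/-! ### The program for Hidden-ID: the search -/

/-- For all candidates `c` in `cs`, perform `passState c` for all elements of the list. -/
def stepLevel {α : Type*} [DecidableEq α] (cs : List α) (l : List (List (List α))) :
    List (List (List α)) :=
  cs.flatMap fun c => l.map (passState c)

theorem length_encRanking_dropThrough (c : List Bool) (r : List (List Bool)) :
    (((dropThrough c r).map encRanking).getD []).length ≤ (encRanking r).length := by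
  induction r with
  | nil => simp [dropThrough]
  | cons w r ih =>
    have hlen : (encRanking (w :: r)).length = w.length + 1 + (encRanking r).length := by
      simp [encRanking, encWord]; omega
    rw [dropThrough]
    split_ifs
    · simp only [Option.map_some, Option.getD_some]
      omega
    · omega

theorem length_encState_passState (c : List Bool) (s : List (List (List Bool))) :
    (encState (passState c s)).length ≤ (encState s).length := by
  induction s with
  | nil => simp [passState]
  | cons r s ih =>
    have hout : encState (passState c (r :: s)) =
        ((dropThrough c r).map encRanking).getD [] ++ encState (passState c s) := by
      cases hd : dropThrough c r <;> simp [encState, passState, hd]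
    have := length_encRanking_dropThrough c r
    have hlen : (encState (r :: s)).length = (encRanking r).length + (encState s).length := by
      simp [encState]
    rw [hout, List.length_append]
    omega

theorem length_encLevel_map_passState (c : List Bool) (l : List (List (List (List Bool)))) :
    (encLevel (l.map (passState c))).length ≤ (encLevel l).length := by
  induction l with
  | nil => simp [encLevel]
  | cons s l ih =>
    have := length_encState_passState c s
    simp only [encLevel, List.map_cons, List.flatMap_cons, List.length_append] at ih ⊢
    omega

theorem encLevel_append (l l' : List (List (List (List Bool)))) :
    encLevel (l ++ l') = encLevel l ++ encLevel l' := by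
  simp [encLevel]

/-- Each candidate contributes a copy of the level with some words deleted. This growth factor is
the source of the power of `|C|` in the running time. -/
theorem length_encLevel_stepLevel (cs : List (List Bool)) (l : List (List (List (List Bool)))) :
    (encLevel (stepLevel cs l)).length ≤ cs.length * (encLevel l).length := by
  induction cs with
  | nil => simp [stepLevel, encLevel]
  | cons c cs ih =>
    have := length_encLevel_map_passState c l
    simp only [stepLevel, List.flatMap_cons, encLevel_append, List.length_append,
      List.length_cons, add_mul] at ih ⊢
    omega

theorem length_le_length_flatMap_encWord (cs : List (List Bool)) :
    cs.length ≤ (cs.flatMap encWord).length := by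
  induction cs with
  | nil => simp
  | cons c cs ih => simp [encWord] at ih ⊢; omega

/-- Take a word from the stack `cand` to the stack `word`, with a copy on the stack
`candDone`. -/
def loadWord : StackProg Reg Token :=
  copyUntil .cand .pre .candDone .comma ;; pop .cand ;; push .candDone .comma ;; move .pre .word

theorem exec_loadWord (c : List Bool) {S : Reg → List Token} {rest : List Token}
    (hc : S .cand = encWord c ++ rest) (hw : S .word = []) (hp : S .pre = []) :
    Exec loadWord S (9 * c.length + 4) (update (update (update S .cand rest) .candDone
      ((encWord c).reverse ++ S .candDone)) .word (c.map .bit)) := by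
  refine Exec.of_eq (Exec.seq (exec_copyUntil (l := c.map .bit) (r := rest) (by decide) (by decide)
    (by decide) (by simp) (by simpa [encWord] using hc)) (Exec.seq (Exec.pop ..)
      (Exec.seq (Exec.push ..) (exec_move (by decide) _)))) ?_ ?_
  · funext k
    cases k <;> simp [hp, hw, encWord]
  · simp [hp]
    omega

/-- Perform `passLoop` for all candidates. -/
def candLoop : StackProg Reg Token :=
  loop .cand Option.isSome (loadWord ;; passLoop ;; clear .word ;; move .buf .lev)

/-- Moving `buf` back to `lev` restores the old level for the next candidate, while the new states
accumulate on `new`. -/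
theorem exec_candLoop_body (c : List Bool) (l : List (List (List (List Bool))))
    {S : Reg → List Token} {rest : List Token} (hc : S .cand = encWord c ++ rest)
    (hl : S .lev = encLevel l) (hb : S .buf = [])
    (hw : S .word = []) (hp : S .pre = []) (hm : S .mis = []) :
    Exec (loadWord ;; passLoop ;; clear .word ;; move .buf .lev) S
      (24 * (((encLevel l).length + 1) * (c.length + 1)))
      (update (update (update S .cand rest) .candDone ((encWord c).reverse ++ S .candDone)) .new
        ((encLevel (l.map (passState c))).reverse ++ S .new)) := by
  have h₂ := exec_loadWord c hc hw hp
  obtain ⟨S₂, hS₂⟩ : ∃ S₂, S₂ = (update (update (update S .cand rest) .candDone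
    ((encWord c).reverse ++ S .candDone)) .word (c.map .bit)) := ⟨_, rfl⟩
  rw [← hS₂] at h₂
  have h₃ := exec_passLoop c l (S := S₂) (by simp [hS₂, hl]) (by simp [hS₂]) (by simp [hS₂, hp])
    (by simp [hS₂, hm])
  have h₄ : Exec (clear .word ;; move .buf .lev) (passResult S₂ [] (encLevel l)
      (encLevel (l.map (passState c)))) (2 * c.length + 1 + (4 * (encLevel l).length + 1))
      (update (update (update S .cand rest) .candDone ((encWord c).reverse ++ S .candDone)) .new
        ((encLevel (l.map (passState c))).reverse ++ S .new)) := by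
    refine Exec.of_eq (Exec.seq (exec_clear ..) (exec_move (by decide) _)) ?_ ?_
    · funext k
      cases k <;> simp [passResult, hS₂, hb, hw, hl]
    · simp [passResult, hS₂, hb]
  refine Exec.of_eq (Exec.seq h₂ (Exec.seq h₃ h₄)) rfl ?_
  have : ((encLevel l).length + 1) * (c.length + 1) =
    (encLevel l).length * (c.length + 1) + c.length + 1 := by ring
  have := Nat.le_mul_of_pos_right (encLevel l).length (show 0 < c.length + 1 by omega)
  omega

theorem exec_candLoop (cs : List (List Bool)) (l : List (List (List (List Bool))))
    {S : Reg → List Token} (hc : S .cand = cs.flatMap encWord) (hl : S .lev = encLevel l)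
    (hb : S .buf = []) (hw : S .word = []) (hp : S .pre = []) (hm : S .mis = []) :
    Exec candLoop S (25 * (((encLevel l).length + 1) * (cs.flatMap encWord).length) + 1)
      (update (update (update S .cand []) .candDone
        ((cs.flatMap encWord).reverse ++ S .candDone)) .new
          ((encLevel (stepLevel cs l)).reverse ++ S .new)) := by
  induction cs generalizing S with
  | nil =>
    have hc' : S .cand = [] := by simpa using hc
    refine Exec.of_eq (Exec.loop_end (by simp [hc'])) ?_ (by simp)
    funext k
    cases k <;> simp [stepLevel, encLevel, hc']
  | cons c cs ih =>
    have hc' : S .cand = encWord c ++ cs.flatMap encWord := by simpa using hc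
    refine Exec.of_eq (Exec.loop_step (by rw [hc']; cases c <;> rfl)
      (exec_candLoop_body c l hc' hl hb hw hp hm)
      (ih (by simp) (by simp [hl]) (by simp [hb]) (by simp [hw]) (by simp [hp]) (by simp [hm])))
      ?_ ?_
    · funext k
      cases k <;> simp [stepLevel, encLevel_append]
    · have hlen : ((c :: cs).flatMap encWord).length =
          c.length + 1 + (cs.flatMap encWord).length := by
        simp [encWord]; omega
      have := Nat.le_mul_of_pos_left (c.length + 1) (show 0 < (encLevel l).length + 1 by omega)
      rw [hlen, Nat.mul_add ((encLevel l).length + 1) (c.length + 1)]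
      omega

/-- Replace the list of lists of rankings on the stack `lev` by its image under `stepLevel`. -/
def searchRound : StackProg Reg Token :=
  candLoop ;; move .candDone .cand ;; clear .lev ;; move .new .lev

theorem exec_searchRound (cs : List (List Bool)) (l : List (List (List (List Bool))))
    {S : Reg → List Token} (hc : S .cand = cs.flatMap encWord) (hl : S .lev = encLevel l)
    (hb : S .buf = []) (hw : S .word = []) (hp : S .pre = []) (hm : S .mis = [])
    (hd : S .candDone = []) (hn : S .new = []) :
    Exec searchRound S (30 * (((encLevel l).length + 1) * ((cs.flatMap encWord).length + 1)))
      (update S .lev (encLevel (stepLevel cs l))) := by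
  have h₁ := exec_candLoop cs l hc hl hb hw hp hm
  refine Exec.of_eq (Exec.seq h₁ (Exec.seq (exec_move (by decide) _) (Exec.seq (exec_clear ..)
    (exec_move (by decide) _)))) ?_ ?_
  · funext k
    cases k <;> simp [hc, hd, hn]
  · simp only [hd, hn, hl, Function.update_self, ne_eq, reduceCtorEq, not_false_eq_true,
      Function.update_of_ne, List.append_nil, List.length_reverse]
    have h₂ := length_encLevel_stepLevel cs l
    have h₃ := Nat.mul_le_mul_right (encLevel l).length (length_le_length_flatMap_encWord cs)
    have : ((encLevel l).length + 1) * ((cs.flatMap encWord).length + 1) =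
      (cs.flatMap encWord).length * (encLevel l).length + (encLevel l).length +
        (cs.flatMap encWord).length + 1 := by ring
    have : ((encLevel l).length + 1) * (cs.flatMap encWord).length =
      (cs.flatMap encWord).length * (encLevel l).length +
        (cs.flatMap encWord).length := by ring
    omega

/-- Perform `searchRound` as often as the height of the stack `cntC` says. -/
def searchLoop : StackProg Reg Token := loop .cntC Option.isSome (pop .cntC ;; searchRound)

theorem exec_searchLoop (cs : List (List Bool)) (l : List (List (List (List Bool)))) (u : ℕ)
    {S : Reg → List Token} (hu : S .cntC = List.replicate u .semi)
    (hc : S .cand = cs.flatMap encWord) (hl : S .lev = encLevel l)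
    (hb : S .buf = []) (hw : S .word = []) (hp : S .pre = []) (hm : S .mis = [])
    (hd : S .candDone = []) (hn : S .new = []) :
    Exec searchLoop S (u * (30 * ((cs.length + 1) ^ u * ((encLevel l).length + 1) *
        ((cs.flatMap encWord).length + 1)) + 2) + 1)
      (update (update S .cntC []) .lev (encLevel ((stepLevel cs)^[u] l))) := by
  induction u generalizing l S with
  | zero =>
    refine Exec.of_eq (Exec.loop_end (by simp [hu])) ?_ (by simp)
    funext k
    cases k <;> simp [hu, hl]
  | succ u ih =>
    rw [List.replicate_succ] at hu
    refine Exec.of_eq (Exec.loop_step (by simp [hu]) (Exec.seq (exec_pop_cons hu)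
      (exec_searchRound cs l (by simp [hc]) (by simp [hl]) (by simp [hb]) (by simp [hw])
        (by simp [hp]) (by simp [hm]) (by simp [hd]) (by simp [hn])))
      (ih (stepLevel cs l) (by simp) (by simp [hc]) (by simp) (by simp [hb]) (by simp [hw])
        (by simp [hp]) (by simp [hm]) (by simp [hd]) (by simp [hn]))) ?_ ?_
    · funext k
      cases k <;> simp
    -- Adding 1 to the length and to the factor makes the growth bound purely multiplicative, so
    -- that it iterates to a power.
    · have h₁ : (encLevel (stepLevel cs l)).length + 1 ≤
          (cs.length + 1) * ((encLevel l).length + 1) := by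
        have := length_encLevel_stepLevel cs l
        have : (cs.length + 1) * ((encLevel l).length + 1) =
          cs.length * (encLevel l).length + (encLevel l).length + cs.length + 1 := by ring
        omega
      set X := (cs.flatMap encWord).length + 1
      set P := (cs.length + 1) ^ (u + 1) * ((encLevel l).length + 1) * X with hP
      have h₂ : (cs.length + 1) ^ u * ((encLevel (stepLevel cs l)).length + 1) * X ≤ P := by
        refine (Nat.mul_le_mul_right X (Nat.mul_le_mul_left _ h₁)).trans_eq ?_
        rw [hP]; ring
      have h₃ : ((encLevel l).length + 1) * X ≤ P := by
        rw [hP, mul_assoc ((cs.length + 1) ^ (u + 1))]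
        exact Nat.le_mul_of_pos_left _ (by positivity)
      have h₄ := Nat.mul_le_mul_left u (show
        30 * ((cs.length + 1) ^ u * ((encLevel (stepLevel cs l)).length + 1) * X) + 2 ≤
          30 * P + 2 by omega)
      have h₅ : (u + 1) * (30 * P + 2) = u * (30 * P + 2) + (30 * P + 2) := by ring
      rw [h₅]
      omega

/-! ### Counting the rankings left in each state. -/

/-- Push a symbol to the stack `res` for every list of rankings on the stack `lev` that is at least
as long as the stack `cntV` is high. -/
def checkLoop : StackProg Reg Token :=
  loop .lev Option.isSome (switch .lev fun
    | some .bar => pop .lev ;; switch .cntV fun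
      | none => skip
      | some x => pop .cntV ;; push .aux x
    | some .semi => pop .lev ;; switch .cntV (fun
      | none => push .res .semi
      | some _ => skip) ;; move .aux .cntV
    | _ => pop .lev)

/-- Each bar moves one symbol from `cntV` to `aux` while there is one. So `cntV` gets empty iff
there are at least `a` bars, and no symbol is lost. -/
theorem exec_checkLoop_inner {i rest : List Token} (hi : Token.semi ∉ i) (a b : ℕ)
    {S S' : Reg → List Token} {T : ℕ} (hl : S .lev = i ++ rest)
    (ha : S .cntV = List.replicate a .semi) (hb : S .aux = List.replicate b .semi)
    (h : Exec checkLoop (update (update (update S .lev rest) .cntV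
      (List.replicate (a - i.count .bar) .semi)) .aux
        (List.replicate (b + min a (i.count .bar)) .semi)) T S') :
    Exec checkLoop S (T + 6 * i.length) S' := by
  induction i generalizing a b S with
  | nil =>
    refine Exec.mono ?_ (Nat.le_add_right _ _)
    convert h using 1
    funext k
    cases k <;> simp_all
  | cons x i ih =>
    have hl' : S .lev = x :: (i ++ rest) := by simpa using hl
    simp only [List.mem_cons, not_or] at hi
    have hpop : Exec (pop .lev) S 1 (update S .lev (i ++ rest)) := exec_pop_cons hl'
    have hplain : x ≠ .bar → Exec checkLoop (update S .lev (i ++ rest)) (T + 6 * i.length) S' := by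
      intro hx
      refine ih hi.2 a b (by simp) (by simp [ha]) (by simp [hb]) ?_
      rw [List.count_cons_of_ne hx] at h
      convert h using 1
      funext k
      cases k <;> simp
    cases x with
    | bit y =>
      exact Exec.of_eq (Exec.loop_step (by simp [hl']) (exec_switch_cons hl' hpop)
        (hplain (by simp))) rfl (by simp; omega)
    | comma =>
      exact Exec.of_eq (Exec.loop_step (by simp [hl']) (exec_switch_cons hl' hpop)
        (hplain (by simp))) rfl (by simp; omega)
    | semi => exact absurd rfl hi.1
    | bar =>
      rw [List.count_cons_self] at h
      cases a with
      | zero =>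
        refine Exec.of_eq (Exec.loop_step (by simp [hl']) (exec_switch_cons hl'
          (Exec.seq hpop (exec_switch_nil (by simp [ha]) (Exec.skip _))))
          (ih hi.2 0 b (by simp) (by simp [ha]) (by simp [hb]) ?_)) rfl (by simp; omega)
        convert h using 1
        funext k
        cases k <;> simp
      | succ a =>
        refine Exec.of_eq (Exec.loop_step (by simp [hl']) (exec_switch_cons hl'
          (Exec.seq hpop (exec_switch_cons (a := .semi) (l := List.replicate a .semi)
            (by simp [ha, List.replicate_succ]) (Exec.seq
              (exec_pop_cons (a := .semi) (l := List.replicate a .semi)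
                (by simp [ha, List.replicate_succ])) (Exec.push ..)))))
          (ih hi.2 a (b + 1) (by simp) (by simp) (by simp [hb, List.replicate_succ]) ?_)) rfl
          (by simp; omega)
        have h₁ : a + 1 - (i.count .bar + 1) = a - i.count .bar := by omega
        have h₂ : b + min (a + 1) (i.count .bar + 1) = b + 1 + min a (i.count .bar) := by omega
        rw [h₁, h₂] at h
        convert h using 1
        funext k
        cases k <;> simp

theorem count_bar_flatMap_encRanking (s : List (List (List Bool))) :
    (s.flatMap encRanking).count .bar = s.length := by
  induction s with
  | nil => rfl
  | cons r s ih =>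
    have := List.count_eq_zero.2 (bar_notMem_flatMap_encWord r)
    rw [List.flatMap_cons, List.count_append, ih, encRanking, List.count_append, this]
    simp; omega

theorem exec_checkLoop (N : ℕ) (l : List (List (List (List Bool)))) {S : Reg → List Token}
    (hl : S .lev = encLevel l) (hN : S .cntV = List.replicate N .semi) (ha : S .aux = []) :
    Exec checkLoop S ((encLevel l).length * (4 * N + 10) + 1)
      (update (update S .lev []) .res
        (List.replicate (l.countP fun s => N ≤ s.length) .semi ++ S .res)) := by
  induction l generalizing S with
  | nil =>
    have hl' : S .lev = [] := by simpa [encLevel] using hl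
    refine Exec.of_eq (Exec.loop_end (by simp [hl'])) ?_ (by simp)
    funext k
    cases k <;> simp [hl']
  | cons s l ih =>
    have hl' : S .lev = s.flatMap encRanking ++ (.semi :: encLevel l) := by
      simpa [encLevel, encState] using hl
    obtain ⟨S₁, hS₁⟩ : ∃ S₁ : Reg → List Token, S₁ = update (update (update S .lev
        (.semi :: encLevel l)) .cntV (List.replicate (N - s.length) .semi)) .aux
        (List.replicate (min N s.length) .semi) := ⟨_, rfl⟩
    have hl₁ : S₁ .lev = .semi :: encLevel l := by simp [hS₁]
    have hsw : Exec (switch .cntV (fun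
        | none => push .res .semi
        | some _ => skip)) (update S₁ .lev (encLevel l)) 2
        (update (update S₁ .lev (encLevel l)) .res
          (List.replicate (if N ≤ s.length then 1 else 0) .semi ++ S .res)) := by
      split_ifs with h
      · refine Exec.of_eq (exec_switch_nil (by simp [hS₁, h]) (Exec.push ..)) ?_ le_rfl
        simp [hS₁]
      · obtain ⟨d, hd⟩ : ∃ d, N - s.length = d + 1 := ⟨N - s.length - 1, by omega⟩
        refine Exec.of_eq (exec_switch_cons (a := .semi) (l := List.replicate d .semi)
          (by simp [hS₁, hd, List.replicate_succ]) (Exec.skip _)) ?_ le_rfl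
        funext k
        cases k <;> simp [hS₁]
    have hbody := Exec.seq (exec_pop_cons hl₁)
      (Exec.seq hsw (exec_move (a := .aux) (b := .cntV) (by decide) _))
    have hS₂ : update (update (update (update S₁ .lev (encLevel l)) .res
        (List.replicate (if N ≤ s.length then 1 else 0) .semi ++ S .res)) .aux []) .cntV
        (List.replicate N .semi) = update (update S .lev (encLevel l)) .res
        (List.replicate (if N ≤ s.length then 1 else 0) .semi ++ S .res) := by
      funext k
      cases k <;> simp [hS₁, hN, ha]
    have hrest := ih (S := update (update S .lev (encLevel l)) .res
        (List.replicate (if N ≤ s.length then 1 else 0) .semi ++ S .res)) (by simp) (by simp [hN])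
        (by simp [ha])
    have hloop : Exec checkLoop S₁ (4 * N + 7 + ((encLevel l).length * (4 * N + 10) + 1))
        (update (update S .lev []) .res
          (List.replicate ((s :: l).countP fun s => N ≤ s.length) .semi ++ S .res)) := by
      refine Exec.of_eq (Exec.loop_step (by simp [hl₁]) (exec_switch_cons hl₁
        (Exec.of_eq hbody (Eq.trans ?_ hS₂) le_rfl)) hrest) ?_ ?_
      -- `min N |s| + (N - |s|) = N`: the threshold is restored for the next state.
      · simp only [hS₁, Function.update_self, ne_eq, reduceCtorEq, not_false_eq_true,
          Function.update_of_ne, List.reverse_replicate, List.replicate_append_replicate]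
        congr 2
        omega
      · rw [List.countP_cons]
        funext k
        cases k <;> simp
        rw [← List.append_assoc, List.replicate_append_replicate]
      · simp [hS₁]
        omega
    have := exec_checkLoop_inner (i := s.flatMap encRanking) (rest := .semi :: encLevel l)
      (by simp [encRanking, encWord]) N 0 hl' hN (by simp [ha]) (by
        rw [count_bar_flatMap_encRanking, zero_add, ← hS₁]
        exact hloop)
    refine this.mono ?_
    have hlen : (encLevel (s :: l)).length =
        (s.flatMap encRanking).length + 1 + (encLevel l).length := by
      simp [encLevel, encState]; omega
    have h₁ := Nat.mul_le_mul_left (s.flatMap encRanking).length (show 6 ≤ 4 * N + 10 by omega)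
    rw [hlen, add_mul, add_mul]
    omega

end StackProg

namespace StackProg

open Function (update)

/-! ### The program for Hidden-ID: reading the input and giving the answer -/

/-- Stacks in which only the given ones may be nonempty. -/
def searchStore (lev cand numC numV cntC cntV rej res : List Token) : Reg → List Token
  | .lev => lev
  | .cand => cand
  | .numC => numC
  | .numV => numV
  | .cntC => cntC
  | .cntV => cntV
  | .rej => rej
  | .res => res
  | _ => []

/-- Move the binary number on top of the stack `lev` to the stack `num`. -/
def readNumber (num : Reg) : StackProg Reg Token :=
  moveWhile .lev .aux (fun x => decide (x ≠ some .comma)) id ;; pop .lev ;; move .aux num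

theorem exec_readNumber {num : Reg} (h₁ : num ≠ .lev) (h₂ : num ≠ .aux) {bs : List Bool}
    {rest : List Token} {S : Reg → List Token} (hl : S .lev = bs.map .bit ++ .comma :: rest)
    (ha : S .aux = []) (hn : S num = []) :
    Exec (readNumber num) S (8 * bs.length + 3)
      (update (update S .lev rest) num (bs.map .bit)) := by
  have hb : ∀ x ∈ bs.map Token.bit, decide (some x ≠ some .comma) = true := by
    intro x hx
    obtain ⟨b, -, rfl⟩ := List.mem_map.1 hx
    simp
  refine Exec.of_eq (Exec.seq (exec_moveWhile (by decide) (l := bs.map .bit) hb (by simp) hl)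
    (Exec.seq (Exec.pop ..) (exec_move h₂.symm _))) ?_ ?_
  · funext k
    simp only [Function.update_apply]
    split_ifs <;> simp_all
  · simp [ha]
    omega

/-- Read the input, which is given on the stack `buf` in reversed order. -/
def readInput : StackProg Reg Token :=
  move .buf .lev ;; readNumber .numC ;; readNumber .numV ;;
  moveWhile .lev .buf (fun x => decide (x ≠ some .bar)) id ;; pop .lev ;;
  moveCount .buf .cand .numC .aux .cntC .comma ;;
  move .lev .buf ;; push .lev .semi ;; moveCount .buf .lev .numV .aux .cntV .bar

/-- The input for the numbers `bm` and `bn`, the candidates `cs` and the rankings `vs`. -/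
def inputTokens (bm bn : List Bool) (cs : List (List Bool)) (vs : List (List (List Bool))) :
    List Token :=
  bm.map .bit ++ .comma :: (bn.map .bit ++ .comma ::
    (cs.flatMap encWord ++ .bar :: vs.flatMap encRanking))

theorem count_comma_flatMap_encWord (cs : List (List Bool)) :
    (cs.flatMap encWord).count .comma = cs.length := by
  induction cs with
  | nil => rfl
  | cons c cs ih =>
    have : (c.map Token.bit).count .comma = 0 := List.count_eq_zero.2 (by simp)
    rw [List.flatMap_cons, List.count_append, ih, encWord, List.count_append, this]
    simp; omega

/-- Commas count the candidates and bars count the voters. The initial level is the single state of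
the empty candidate list, consisting of all complete rankings. -/
theorem exec_readInput (bm bn : List Bool) (cs : List (List Bool)) (vs : List (List (List Bool))) :
    ∃ bm' bn' : List Bool, bm'.length ≤ bm.length ∧ bn'.length ≤ bn.length ∧
      binValue bm' = binValue bm - cs.length ∧ binValue bn' = binValue bn - vs.length ∧
      Exec readInput (update (fun _ => []) .buf (inputTokens bm bn cs vs).reverse)
        (48 * ((inputTokens bm bn cs vs).length + 1) ^ 2)
        (searchStore (encLevel [vs]) (cs.flatMap encWord) (bm'.map .bit) (bn'.map .bit)
          (List.replicate (min (binValue bm) cs.length) .semi)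
          (List.replicate (min (binValue bn) vs.length) .semi) [] []) := by
  set C := cs.flatMap encWord with hC
  set V := vs.flatMap encRanking with hV
  have e₁ : Exec (move .buf .lev) (update (fun _ => []) .buf (inputTokens bm bn cs vs).reverse)
      (4 * (inputTokens bm bn cs vs).length + 1)
      (searchStore (inputTokens bm bn cs vs) [] [] [] [] [] [] []) := by
    refine Exec.of_eq (exec_move (by decide) _) ?_ (by simp)
    funext k
    cases k <;> simp [searchStore]
  have e₂ : Exec (readNumber .numC) (searchStore (inputTokens bm bn cs vs) [] [] [] [] [] [] [])
      (8 * bm.length + 3) (searchStore (bn.map .bit ++ .comma :: (C ++ .bar :: V)) []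
        (bm.map .bit) [] [] [] [] []) := by
    refine Exec.of_eq (exec_readNumber (bs := bm) (by decide) (by decide) rfl rfl rfl) ?_ le_rfl
    funext k
    cases k <;> simp [searchStore, hC, hV]
  have e₃ : Exec (readNumber .numV) (searchStore (bn.map .bit ++ .comma :: (C ++ .bar :: V)) []
        (bm.map .bit) [] [] [] [] []) (8 * bn.length + 3)
      (searchStore (C ++ .bar :: V) [] (bm.map .bit) (bn.map .bit) [] [] [] []) := by
    refine Exec.of_eq (exec_readNumber (bs := bn) (by decide) (by decide) rfl rfl rfl) ?_ le_rfl
    funext k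
    cases k <;> simp [searchStore]
  have e₄ : Exec (moveWhile .lev .buf (fun x => decide (x ≠ some .bar)) id)
      (searchStore (C ++ .bar :: V) [] (bm.map .bit) (bn.map .bit) [] [] [] []) (4 * C.length + 1)
      (update (searchStore (.bar :: V) [] (bm.map .bit) (bn.map .bit) [] [] [] []) .buf
        C.reverse) := by
    refine Exec.of_eq (exec_moveWhile (by decide) (l := C) (r := .bar :: V) ?_ (by simp) rfl) ?_
      le_rfl
    · intro x hx
      have := bar_notMem_flatMap_encWord cs
      simp only [ne_eq, Option.some.injEq, decide_eq_true_eq]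
      rintro rfl
      exact this hx
    · funext k
      cases k <;> simp [searchStore]
  have e₅ : Exec (pop .lev)
      (update (searchStore (.bar :: V) [] (bm.map .bit) (bn.map .bit) [] [] [] []) .buf C.reverse) 1
      (update (searchStore V [] (bm.map .bit) (bn.map .bit) [] [] [] []) .buf C.reverse) := by
    refine Exec.of_eq (Exec.pop ..) ?_ le_rfl
    funext k
    cases k <;> simp [searchStore]
  obtain ⟨bm', hm₁, hm₂, e₆⟩ := exec_moveCount (a := .buf) (b := .cand) (num := .numC) (aux := .aux)
    (un := .cntC) (by decide) .comma (S := update (searchStore V [] (bm.map .bit) (bn.map .bit)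
      [] [] [] []) .buf C.reverse) C.reverse bm (by simp) (by simp [searchStore])
      (by simp [searchStore])
  rw [List.count_reverse, count_comma_flatMap_encWord] at hm₂
  replace e₆ := e₆.of_eq (T₂ := C.length * (8 * bm.length + 10) + 1)
    (S₂ := searchStore V C (bm'.map .bit) (bn.map .bit)
      (List.replicate (min (binValue bm) cs.length) .semi) [] [] []) (by
      have : binValue bm - binValue bm' = min (binValue bm) cs.length := by omega
      rw [this]
      funext k
      cases k <;> simp [searchStore]) (by simp)
  have e₇ : Exec (move .lev .buf) (searchStore V C (bm'.map .bit) (bn.map .bit)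
      (List.replicate (min (binValue bm) cs.length) .semi) [] [] []) (4 * V.length + 1)
      (update (searchStore [] C (bm'.map .bit) (bn.map .bit)
      (List.replicate (min (binValue bm) cs.length) .semi) [] [] []) .buf V.reverse) := by
    refine Exec.of_eq (exec_move (by decide) _) ?_ (by simp [searchStore])
    funext k
    cases k <;> simp [searchStore]
  -- The symbol that ends the state has to lie below the rankings, so it is pushed before them.
  have e₈ : Exec (push .lev .semi) (update (searchStore [] C (bm'.map .bit) (bn.map .bit)
      (List.replicate (min (binValue bm) cs.length) .semi) [] [] []) .buf V.reverse) 1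
      (update (searchStore [.semi] C (bm'.map .bit) (bn.map .bit)
      (List.replicate (min (binValue bm) cs.length) .semi) [] [] []) .buf V.reverse) := by
    refine Exec.of_eq (Exec.push ..) ?_ le_rfl
    funext k
    cases k <;> simp [searchStore]
  obtain ⟨bn', hn₁, hn₂, e₉⟩ := exec_moveCount (a := .buf) (b := .lev) (num := .numV) (aux := .aux)
    (un := .cntV) (by decide) .bar (S := update (searchStore [.semi] C (bm'.map .bit) (bn.map .bit)
      (List.replicate (min (binValue bm) cs.length) .semi) [] [] []) .buf V.reverse)
      V.reverse bn (by simp) (by simp [searchStore]) (by simp [searchStore])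
  rw [List.count_reverse, count_bar_flatMap_encRanking] at hn₂
  replace e₉ := e₉.of_eq (T₂ := V.length * (8 * bn.length + 10) + 1)
    (S₂ := searchStore (encLevel [vs]) C (bm'.map .bit) (bn'.map .bit)
      (List.replicate (min (binValue bm) cs.length) .semi)
      (List.replicate (min (binValue bn) vs.length) .semi) [] []) (by
      have : binValue bn - binValue bn' = min (binValue bn) vs.length := by omega
      rw [this]
      funext k
      cases k <;> simp [searchStore, encLevel, encState, hV]) (by simp)
  refine ⟨bm', bn', hm₁, hn₁, hm₂, hn₂, Exec.of_eq (Exec.seq e₁ (Exec.seq e₂ (Exec.seq e₃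
    (Exec.seq e₄ (Exec.seq e₅ (Exec.seq e₆ (Exec.seq e₇ (Exec.seq e₈ e₉)))))))) rfl ?_⟩
  have hlen : (inputTokens bm bn cs vs).length = bm.length + bn.length + C.length + V.length + 3 := by
    simp only [inputTokens, List.length_append, List.length_cons, List.length_map, ← hC, ← hV]
    omega
  set n := (inputTokens bm bn cs vs).length
  have h₁ : C.length * (8 * bm.length + 10) ≤ n * (8 * n + 10) :=
    Nat.mul_le_mul (by omega) (by omega)
  have h₂ : V.length * (8 * bn.length + 10) ≤ n * (8 * n + 10) :=
    Nat.mul_le_mul (by omega) (by omega)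
  have h₃ : n * (8 * n + 10) = 8 * (n * n) + 10 * n := by ring
  have h₄ : (n + 1) ^ 2 = n * n + 2 * n + 1 := by ring
  rw [h₄]
  omega

/-- Give the answer: an element of the stack `res` is a certificate, but the stack `res` does not
matter if one of the numbers on the stacks `numC` and `numV` is positive. -/
def giveAnswer : StackProg Reg Token :=
  countdown .numC .aux .rej ;; countdown .numV .aux .rej ;; switch .rej (fun
    | none => skip
    | some _ => clear .res) ;;
  clear .rej ;; clear .numC ;; clear .numV ;; clear .cand ;; clear .cntV ;; switch .res fun
    | none => skip
    | some _ => clear .res ;; push .res .semi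

/-- The numbers are the excesses `m' - |C|` and `n' - |V|`; `rej` stays empty iff both vanish. The
`j` symbols on `res` stand for the successful candidate lists, and are reduced to at most one. -/
theorem exec_giveAnswer (bm bn : List Bool) (C D : List Token) (j : ℕ) :
    Exec giveAnswer (searchStore [] C (bm.map .bit) (bn.map .bit) [] D []
        (List.replicate j .semi)) (10 * bm.length + 10 * bn.length + 4 * j + 2 * C.length +
          2 * D.length + 40)
      (update (fun _ => []) .res
        (if binValue bm = 0 ∧ binValue bn = 0 ∧ 0 < j then [.semi] else [])) := by
  obtain ⟨bm', hm₁, hm₂, e₁⟩ := exec_countdown (num := Reg.numC) (aux := .aux) (un := .rej)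
    (by decide) (by decide) (by decide)
    (S := searchStore [] C (bm.map .bit) (bn.map .bit) [] D [] (List.replicate j .semi)) bm rfl rfl
  obtain ⟨i₁, hi₁⟩ : ∃ i, binValue bm - binValue bm' = i := ⟨_, rfl⟩
  rw [hi₁] at e₁
  replace e₁ := e₁.of_eq (S₂ := searchStore [] C (bm'.map .bit) (bn.map .bit) [] D
    (List.replicate i₁ .semi) (List.replicate j .semi)) (by
      funext k
      cases k <;> simp [searchStore]) le_rfl
  obtain ⟨bn', hn₁, hn₂, e₂⟩ := exec_countdown (num := Reg.numV) (aux := .aux) (un := .rej)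
    (by decide) (by decide) (by decide) (S := searchStore [] C (bm'.map .bit) (bn.map .bit) [] D
      (List.replicate i₁ .semi) (List.replicate j .semi)) bn rfl rfl
  obtain ⟨i₂, hi₂⟩ : ∃ i, binValue bn - binValue bn' = i := ⟨_, rfl⟩
  rw [hi₂] at e₂
  obtain ⟨i, hi⟩ : ∃ i, i₂ + i₁ = i := ⟨_, rfl⟩
  replace e₂ := e₂.of_eq (S₂ := searchStore [] C (bm'.map .bit) (bn'.map .bit) [] D
    (List.replicate i .semi) (List.replicate j .semi)) (by
      funext k
      cases k <;> simp [searchStore, hi]) le_rfl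
  have hiz : i = 0 ↔ binValue bm = 0 ∧ binValue bn = 0 := by omega
  have hile : i ≤ 2 := by omega
  obtain ⟨j', hj'⟩ : ∃ j', j' = if i = 0 then j else 0 := ⟨_, rfl⟩
  have e₃ : Exec (switch .rej (fun
      | none => skip
      | some _ => clear .res)) (searchStore [] C (bm'.map .bit) (bn'.map .bit) [] D
        (List.replicate i .semi) (List.replicate j .semi)) (2 * j + 2)
      (searchStore [] C (bm'.map .bit) (bn'.map .bit) [] D
        (List.replicate i .semi) (List.replicate j' .semi)) := by
    cases i with
    | zero =>
      refine Exec.mono (exec_switch_nil rfl (Exec.of_eq (Exec.skip _) ?_ le_rfl)) (by omega)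
      simp [hj']
    | succ i =>
      refine Exec.mono (exec_switch_cons (a := .semi) (l := List.replicate i .semi) rfl
        (Exec.of_eq (exec_clear ..) ?_ le_rfl)) ?_
      · funext k
        cases k <;> simp [searchStore, hj']
      · simp [searchStore]
  have e₄ : Exec (clear .rej) _ (2 * i + 1) (searchStore [] C (bm'.map .bit) (bn'.map .bit) [] D
      [] (List.replicate j' .semi)) :=
    Exec.of_eq (exec_clear _ (searchStore [] C (bm'.map .bit) (bn'.map .bit) [] D
      (List.replicate i .semi) (List.replicate j' .semi))) (by
        funext k
        cases k <;> simp [searchStore]) (by simp [searchStore])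
  have e₅ : Exec (clear .numC) _ (2 * bm'.length + 1) (searchStore [] C [] (bn'.map .bit) [] D
      [] (List.replicate j' .semi)) :=
    Exec.of_eq (exec_clear _ (searchStore [] C (bm'.map .bit) (bn'.map .bit) [] D
      [] (List.replicate j' .semi))) (by
        funext k
        cases k <;> simp [searchStore]) (by simp [searchStore])
  have e₆ : Exec (clear .numV) _ (2 * bn'.length + 1) (searchStore [] C [] [] [] D
      [] (List.replicate j' .semi)) :=
    Exec.of_eq (exec_clear _ (searchStore [] C [] (bn'.map .bit) [] D
      [] (List.replicate j' .semi))) (by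
        funext k
        cases k <;> simp [searchStore]) (by simp [searchStore])
  have e₇ : Exec (clear .cand) _ (2 * C.length + 1) (searchStore [] [] [] [] [] D
      [] (List.replicate j' .semi)) :=
    Exec.of_eq (exec_clear _ (searchStore [] C [] [] [] D
      [] (List.replicate j' .semi))) (by
        funext k
        cases k <;> simp [searchStore]) (by simp [searchStore])
  have e₈ : Exec (clear .cntV) _ (2 * D.length + 1) (searchStore [] [] [] [] [] []
      [] (List.replicate j' .semi)) :=
    Exec.of_eq (exec_clear _ (searchStore [] [] [] [] [] D
      [] (List.replicate j' .semi))) (by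
        funext k
        cases k <;> simp [searchStore]) (by simp [searchStore])
  have e₉ : Exec (switch .res fun
      | none => skip
      | some _ => clear .res ;; push .res .semi) (searchStore [] [] [] [] [] []
      [] (List.replicate j' .semi)) (2 * j' + 3) (update (fun _ => []) .res
        (if binValue bm = 0 ∧ binValue bn = 0 ∧ 0 < j then [.semi] else [])) := by
    have hif : (binValue bm = 0 ∧ binValue bn = 0 ∧ 0 < j) ↔ 0 < j' := by
      rw [hj', ← and_assoc, ← hiz]
      split_ifs <;> simp_all
    simp only [hif]
    cases j' with
    | zero =>
      refine Exec.mono (exec_switch_nil rfl (Exec.of_eq (Exec.skip _) ?_ le_rfl)) (by omega)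
      funext k
      cases k <;> simp [searchStore]
    | succ j' =>
      refine Exec.mono (exec_switch_cons (a := .semi) (l := List.replicate j' .semi) rfl
        (Exec.of_eq (Exec.seq (exec_clear ..) (Exec.push ..)) ?_ le_rfl)) ?_
      · funext k
        cases k <;> simp [searchStore]
      · simp [searchStore]
  have hjj : j' ≤ j := by rw [hj']; split_ifs <;> omega
  exact Exec.of_eq (Exec.seq e₁ (Exec.seq e₂ (Exec.seq e₃ (Exec.seq e₄ (Exec.seq e₅ (Exec.seq e₆
    (Exec.seq e₇ (Exec.seq e₈ e₉)))))))) rfl (by omega)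

end StackProg

namespace StackProg

open Function (update)

/-! ### The meaning of the search -/

/-- Delete from a list successively everything up to the next occurrence of an element of `s`. -/
def dropSeq {α : Type*} [DecidableEq α] : List α → List α → Option (List α)
  | [], r => some r
  | c :: s, r => (dropThrough c r).bind (dropSeq s)

/-- Greedy matching is optimal: if `c :: s` embeds in a list, then `s` embeds in what follows the
first occurrence of `c`. -/
theorem isSome_dropSeq {α : Type*} [DecidableEq α] (s r : List α) :
    (dropSeq s r).isSome = true ↔ s.Sublist r := by
  induction s generalizing r with
  | nil => simp [dropSeq]
  | cons c s ih =>
    induction r with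
    | nil => simp [dropSeq, dropThrough]
    | cons w r ihr =>
      rw [dropSeq] at ihr
      by_cases h : w = c
      · subst h
        simp [dropSeq, dropThrough, ih]
      · simp only [dropSeq, dropThrough, h, if_false, ihr]
        rw [List.sublist_cons_iff]
        refine ⟨Or.inl, fun h' => h'.resolve_right ?_⟩
        rintro ⟨_, he, -⟩
        exact h (List.cons.inj he).1.symm

/-- Successive passes compose, because `filterMap` of `dropThrough c` followed by `filterMap` of
`dropSeq s` is `filterMap` of `dropSeq (c :: s)`. -/
theorem mem_iterate_stepLevel {α : Type*} [DecidableEq α] {cs : List α} {u : ℕ}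
    {l : List (List (List α))} {t : List (List α)} :
    t ∈ (stepLevel cs)^[u] l ↔ ∃ s : List α, s.length = u ∧ (∀ c ∈ s, c ∈ cs) ∧
      ∃ v ∈ l, t = v.filterMap (dropSeq s) := by
  induction u generalizing l with
  | zero =>
    have : dropSeq ([] : List α) = some := by funext r; rfl
    simp [this]
  | succ u ih =>
    rw [Function.iterate_succ_apply, ih]
    constructor
    · rintro ⟨s, rfl, hs, v, hv, rfl⟩
      simp only [stepLevel, List.mem_flatMap, List.mem_map] at hv
      obtain ⟨c, hc, v, hv, rfl⟩ := hv
      refine ⟨c :: s, by simp, by simpa using ⟨hc, hs⟩, v, hv, ?_⟩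
      rw [passState, List.filterMap_filterMap]
      rfl
    · rintro ⟨s, hl, hs, v, hv, rfl⟩
      obtain ⟨c, s, rfl⟩ := List.exists_cons_of_length_eq_add_one hl
      refine ⟨s, by simpa using hl, fun x hx => hs x (by simp [hx]), passState c v, ?_, ?_⟩
      · simp only [stepLevel, List.mem_flatMap, List.mem_map]
        exact ⟨c, hs c (by simp), v, hv, rfl⟩
      · rw [passState, List.filterMap_filterMap]
        rfl

theorem exists_mem_iterate_stepLevel {α : Type*} [DecidableEq α] {cs : List α} {u N : ℕ}
    {vs : List (List α)} :
    (∃ t ∈ (stepLevel cs)^[u] [vs], N ≤ t.length) ↔ ∃ s : List α, s.length = u ∧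
      (∀ c ∈ s, c ∈ cs) ∧ N ≤ vs.countP (fun r => decide (s.Sublist r)) := by
  have h : ∀ s : List α, (vs.filterMap (dropSeq s)).length =
      vs.countP (fun r => decide (s.Sublist r)) := by
    intro s
    rw [List.length_filterMap_eq_countP]
    refine List.countP_congr fun r _ => ?_
    rw [isSome_dropSeq]
    simp
  constructor
  · rintro ⟨t, ht, hN⟩
    obtain ⟨s, hs, hc, v, hv, rfl⟩ := mem_iterate_stepLevel.1 ht
    obtain rfl := List.mem_singleton.1 hv
    exact ⟨s, hs, hc, by rwa [← h]⟩
  · rintro ⟨s, hs, hc, hN⟩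
    exact ⟨_, mem_iterate_stepLevel.2 ⟨s, hs, hc, vs, by simp, rfl⟩, by rwa [h]⟩

/-! ### Correctness and running time of the complete program. -/

/-- The complete program for Hidden-ID. -/
def hiddenIDProg : StackProg Reg Token := readInput ;; searchLoop ;; checkLoop ;; giveAnswer

theorem length_encLevel_iterate (cs : List (List Bool)) (u : ℕ)
    (l : List (List (List (List Bool)))) :
    (encLevel ((stepLevel cs)^[u] l)).length + 1 ≤
      (cs.length + 1) ^ u * ((encLevel l).length + 1) := by
  induction u with
  | zero => simp
  | succ u ih =>
    rw [Function.iterate_succ_apply']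
    have h₁ := length_encLevel_stepLevel cs ((stepLevel cs)^[u] l)
    calc _ ≤ (cs.length + 1) * ((encLevel ((stepLevel cs)^[u] l)).length + 1) := by
          rw [add_mul, mul_add]; omega
      _ ≤ (cs.length + 1) * ((cs.length + 1) ^ u * ((encLevel l).length + 1)) :=
          Nat.mul_le_mul_left _ ih
      _ = _ := by ring

theorem length_le_length_encLevel (l : List (List (List (List Bool)))) :
    l.length ≤ (encLevel l).length := by
  induction l with
  | nil => simp
  | cons s l ih =>
    simp only [encLevel, List.flatMap_cons, encState, List.length_append, List.length_cons,
      List.length_nil] at ih ⊢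
    omega

/-- The search uses the truncated numbers; if a truncation is strict, the excess forces a rejection
whatever the search finds. With `n` the input length and `P` the power of `|C| + 1`, the dominant
cost is at most `n + 1` rounds of order `P * (n + 1) ^ 2`. -/
theorem exec_hiddenIDProg (bm bn : List Bool) (cs : List (List Bool))
    (vs : List (List (List Bool))) (b : Bool)
    (hb : b = true ↔ binValue bm ≤ cs.length ∧ binValue bn ≤ vs.length ∧ ∃ s : List (List Bool),
      s.length = min (binValue bm) cs.length ∧ (∀ c ∈ s, c ∈ cs) ∧
        min (binValue bn) vs.length ≤ vs.countP (fun r => decide (s.Sublist r))) :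
    Exec hiddenIDProg (update (fun _ => []) .buf (inputTokens bm bn cs vs).reverse)
      (200 * ((cs.length + 1) ^ min (binValue bm) cs.length *
        ((inputTokens bm bn cs vs).length + 1) ^ 3))
      (update (fun _ => []) .res (if b then [.semi] else [])) := by
  obtain ⟨bm', bn', hm₁, hn₁, hm₂, hn₂, e₁⟩ := exec_readInput bm bn cs vs
  set u := min (binValue bm) cs.length with hu
  set N := min (binValue bn) vs.length with hN
  set l := (stepLevel cs)^[u] [vs] with hl
  set j := l.countP (fun s => N ≤ s.length) with hj
  have e₂ := exec_searchLoop cs [vs] u (S := searchStore (encLevel [vs]) (cs.flatMap encWord)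
    (bm'.map .bit) (bn'.map .bit) (List.replicate u .semi) (List.replicate N .semi) [] [])
    rfl rfl rfl rfl rfl rfl rfl rfl rfl
  replace e₂ := e₂.of_eq (S₂ := searchStore (encLevel l) (cs.flatMap encWord)
    (bm'.map .bit) (bn'.map .bit) [] (List.replicate N .semi) [] []) (by
      funext k
      cases k <;> simp [searchStore, hl]) le_rfl
  have e₃ := exec_checkLoop N l (S := searchStore (encLevel l) (cs.flatMap encWord)
    (bm'.map .bit) (bn'.map .bit) [] (List.replicate N .semi) [] []) rfl rfl rfl
  replace e₃ := e₃.of_eq (S₂ := searchStore [] (cs.flatMap encWord)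
    (bm'.map .bit) (bn'.map .bit) [] (List.replicate N .semi) [] (List.replicate j .semi)) (by
      funext k
      cases k <;> simp [searchStore, hj]) le_rfl
  have e₄ := exec_giveAnswer bm' bn' (cs.flatMap encWord) (List.replicate N .semi) j
  have hb' : b = true ↔ binValue bm' = 0 ∧ binValue bn' = 0 ∧ 0 < j := by
    rw [hb, ← exists_mem_iterate_stepLevel, hj, List.countP_pos_iff]
    simp only [decide_eq_true_eq]
    rw [hm₂, hn₂, Nat.sub_eq_zero_iff_le, Nat.sub_eq_zero_iff_le]
  refine Exec.of_eq (Exec.seq e₁ (Exec.seq e₂ (Exec.seq e₃ e₄))) (by simp only [hb']) ?_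
  clear hb hb' e₁ e₂ e₃ e₄
  have hlen : (inputTokens bm bn cs vs).length = bm.length + bn.length +
      (cs.flatMap encWord).length + (vs.flatMap encRanking).length + 3 := by
    simp only [inputTokens, List.length_append, List.length_cons, List.length_map]
    omega
  have hlev : (encLevel [vs]).length = (vs.flatMap encRanking).length + 1 := by
    simp [encLevel, encState]
  have hcs := length_le_length_flatMap_encWord cs
  have hvs : vs.length ≤ (vs.flatMap encRanking).length := by
    rw [← count_bar_flatMap_encRanking]
    exact List.count_le_length
  have hjl : j ≤ (encLevel l).length := List.countP_le_length.trans (length_le_length_encLevel l)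
  have hlP := length_encLevel_iterate cs u [vs]
  rw [← hl] at hlP
  set n := (inputTokens bm bn cs vs).length
  set P := (cs.length + 1) ^ u with hP
  have hP₁ : 1 ≤ P := Nat.one_le_pow _ _ (by omega)
  have hlPn : (encLevel l).length + 1 ≤ P * (n + 1) :=
    hlP.trans (Nat.mul_le_mul_left P (by omega))
  have h₁ : P * ((encLevel [vs]).length + 1) * ((cs.flatMap encWord).length + 1) ≤
      P * (n + 1) * (n + 1) := Nat.mul_le_mul (Nat.mul_le_mul_left P (by omega)) (by omega)
  have h₂ : u * (30 * (P * ((encLevel [vs]).length + 1) * ((cs.flatMap encWord).length + 1)) + 2) ≤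
      (n + 1) * (30 * (P * (n + 1) * (n + 1)) + 2) := Nat.mul_le_mul (by omega) (by omega)
  have h₃ : (encLevel l).length * (4 * N + 10) ≤ P * (n + 1) * (10 * (n + 1)) :=
    Nat.mul_le_mul (by omega) (by omega)
  have hQ₁ : P * (n + 1) * (10 * (n + 1)) = 10 * (P * (n + 1) ^ 2) := by ring
  have hQ₂ : (n + 1) * (30 * (P * (n + 1) * (n + 1)) + 2) = 30 * (P * (n + 1) ^ 3) + 2 * (n + 1) := by
    ring
  have hR₁ : P * (n + 1) ^ 2 ≤ P * (n + 1) ^ 3 :=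
    Nat.mul_le_mul_left P (Nat.pow_le_pow_right (by omega) (by omega))
  have hR₂ : P * (n + 1) ≤ P * (n + 1) ^ 2 :=
    Nat.mul_le_mul_left P (Nat.le_self_pow (by omega) _)
  have hR₃ : (n + 1) ^ 2 ≤ P * (n + 1) ^ 2 := Nat.le_mul_of_pos_left _ hP₁
  have hR₄ : n + 1 ≤ P * (n + 1) := Nat.le_mul_of_pos_left _ hP₁
  simp only [List.length_replicate]
  omega

end StackProg

open StackProg

/-! ### Hidden-ID in terms of lists -/

theorem isIdentity_sub_iff {C V : Type} (E : Election C V) (C' : Finset C) (V' : Finset V) :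
    (E.sub C' V').IsIdentity ↔
      ∀ v ∈ V', ∀ w ∈ V', ∀ c ∈ C', ∀ d ∈ C', E.pref v c d ↔ E.pref w c d := by
  constructor
  · intro h v hv w hw c hc d hd
    exact iff_of_eq (congrFun (congrFun (h ⟨v, hv⟩ ⟨w, hw⟩) ⟨c, hc⟩) ⟨d, hd⟩)
  · rintro h ⟨v, hv⟩ ⟨w, hw⟩
    funext ⟨c, hc⟩ ⟨d, hd⟩
    exact propext (h v hv w hw c hc d hd)

theorem pref_of_sublist_rankingList {m : ℕ} {V : Type} (E : Election (Fin m) V)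
    {s : List (Fin m)} {v w : V} (hv : s.Sublist (E.rankingList v))
    (hw : s.Sublist (E.rankingList w)) {c d : Fin m} (hc : c ∈ s) (hd : d ∈ s)
    (h : E.pref v c d) : E.pref w c d := by
  have hne : c ≠ d := by
    rintro rfl
    exact (E.ranking v).irrefl _ h
  -- The order in which two candidates occur in `s` is that of both voters. The second disjunct
  -- makes the relation symmetric, so that it holds for all pairs of distinct members.
  have hp : s.Pairwise fun a b => (E.pref v a b ∧ E.pref w a b) ∨ (E.pref v b a ∧ E.pref w b a) :=
    (((E.rankingList_pairwise v).sublist hv).and ((E.rankingList_pairwise w).sublist hw)).imp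
      fun h => Or.inl h
  have : Std.Symm fun a b => (E.pref v a b ∧ E.pref w a b) ∨ (E.pref v b a ∧ E.pref w b a) :=
    ⟨fun _ _ h => h.symm⟩
  rcases hp.forall hc hd hne with h' | h'
  · exact h'.2
  · exact absurd ((E.ranking v).trans _ _ _ h h'.1) ((E.ranking v).irrefl _)

/-- Both lists are permutations of each other and sorted by the same strict order. -/
theorem filter_rankingList_eq {m : ℕ} {V : Type} (E : Election (Fin m) V) {C' : Finset (Fin m)}
    {v w : V} (h : ∀ c ∈ C', ∀ d ∈ C', E.pref v c d ↔ E.pref w c d) :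
    (E.rankingList v).filter (· ∈ C') = (E.rankingList w).filter (· ∈ C') := by
  have hperm := (E.rankingList_perm v).trans (E.rankingList_perm w).symm
  refine (hperm.filter _).eq_of_pairwise (le := E.pref v) ?_
    ((E.rankingList_pairwise v).filter _) ?_
  · intro a b _ _ hab hba
    exact absurd ((E.ranking v).trans _ _ _ hab hba) ((E.ranking v).irrefl _)
  · refine ((E.rankingList_pairwise w).filter _).imp_of_mem ?_
    intro a b ha hb hab
    simp only [List.mem_filter, decide_eq_true_eq] at ha hb
    exact (h a ha.2 b hb.2).2 hab

/-- Given `C'` and `V'`, shrink `C'` to exactly `m'` candidates and list them as some voter of `V'`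
does. Given `s`, take its members and all voters whose rankings contain it. -/
theorem mem_hiddenID_iff (I : HiddenIDInstance) : I ∈ HiddenID ↔
    I.minCandidates ≤ I.numCandidates ∧ I.minVoters ≤ I.numVoters ∧
      ∃ s : List (Fin I.numCandidates), s.length = I.minCandidates ∧
        I.minVoters ≤ (List.finRange I.numVoters).countP
          (fun v => decide (s.Sublist (I.election.rankingList v))) := by
  have hcount : ∀ s : List (Fin I.numCandidates), (List.finRange I.numVoters).countP
        (fun v => decide (s.Sublist (I.election.rankingList v))) =
      (Finset.univ.filter fun v => s.Sublist (I.election.rankingList v)).card := by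
    intro s
    rw [List.countP_eq_length_filter, ← List.toFinset_card_of_nodup
      ((List.nodup_finRange _).filter _)]
    congr 1
    ext v
    simp
  simp only [hcount]
  constructor
  · rintro ⟨C', V', hid, hC, hV⟩
    rw [isIdentity_sub_iff] at hid
    have hC₁ : C'.card ≤ I.numCandidates := by simpa using Finset.card_le_univ C'
    have hV₁ : V'.card ≤ I.numVoters := by simpa using Finset.card_le_univ V'
    obtain ⟨D, hDC, hD⟩ := Finset.exists_subset_card_eq hC
    refine ⟨hC.trans hC₁, hV.trans hV₁, ?_⟩
    -- Without a voter there is no ranking to read off, but then `n' = 0` and any list of length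
    -- `m'` will do.
    rcases V'.eq_empty_or_nonempty with rfl | ⟨v₀, hv₀⟩
    · exact ⟨D.toList, by simpa using hD, by simp at hV; simp [hV]⟩
    · refine ⟨(I.election.rankingList v₀).filter (· ∈ D), ?_, hV.trans (Finset.card_le_card ?_)⟩
      · rw [((I.election.rankingList_perm v₀).filter _).length_eq, ← hD,
          ← List.toFinset_card_of_nodup ((List.nodup_finRange _).filter _)]
        congr 1
        ext c
        simp
      · intro v hv
        rw [Finset.mem_filter]
        refine ⟨Finset.mem_univ _, ?_⟩
        rw [filter_rankingList_eq I.election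
          (fun c hc d hd => hid v₀ hv₀ v hv c (hDC hc) d (hDC hd))]
        exact List.filter_sublist
  · rintro ⟨hm, hn, s, hs, hV⟩
    -- If `n' = 0`, then `s` may have repetitions and too few members, so all candidates and no
    -- voters are taken. Otherwise `s` is contained in a ranking and has no repetitions.
    rcases Nat.eq_zero_or_pos I.minVoters with h0 | h0
    · refine ⟨Finset.univ, ∅, ?_, by simpa using hm, by simp [h0]⟩
      rw [isIdentity_sub_iff]
      simp
    · refine ⟨s.toFinset, _, ?_, ?_, hV⟩
      · rw [isIdentity_sub_iff]
        simp only [Finset.mem_filter, Finset.mem_univ, true_and, List.mem_toFinset]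
        exact fun v hv w hw c hc d hd => ⟨pref_of_sublist_rankingList _ hv hw hc hd,
          pref_of_sublist_rankingList _ hw hv hc hd⟩
      · obtain ⟨v, hv⟩ := Finset.card_pos.1 (h0.trans_le hV)
        rw [Finset.mem_filter] at hv
        rw [List.toFinset_card_of_nodup (hv.2.nodup ((I.election.rankingList_perm v).nodup_iff.2
          (List.nodup_finRange _))), hs]

open StackProg

/-! ### The encoding of the input -/

/-- The symbols of the input as symbols of the program. -/
def InputSymbol.toToken : InputSymbol → Token
  | .bit b => .bit b
  | .comma => .comma
  | .bar => .bar

noncomputable instance : Fintype InputSymbol :=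
  Fintype.ofInjective InputSymbol.toToken fun a b => by
    cases a <;> cases b <;> simp [InputSymbol.toToken]

/-- The candidates of an instance, as binary words. -/
def HiddenIDInstance.candWords (I : HiddenIDInstance) : List (List Bool) :=
  (List.finRange I.numCandidates).map fun c => c.val.bits

/-- The rankings of an instance, as lists of binary words. -/
noncomputable def HiddenIDInstance.rankingWords (I : HiddenIDInstance) : List (List (List Bool)) :=
  (List.finRange I.numVoters).map fun v => (I.election.rankingList v).map fun c => c.val.bits

theorem encodeNumber_map_toToken (k : ℕ) :
    (encodeNumber k).map InputSymbol.toToken = encWord k.bits := by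
  simp [encodeNumber, encWord, InputSymbol.toToken]

theorem encodeNumbers_map_toToken {α : Type*} (f : α → ℕ) (l : List α) :
    (encodeNumbers (l.map f)).map InputSymbol.toToken =
      encRanking (l.map fun a => (f a).bits) := by
  simp only [encodeNumbers, encRanking, List.map_append, List.map_flatMap, List.flatMap_map,
    encodeNumber_map_toToken]
  rfl

theorem encode_map_toToken (I : HiddenIDInstance) : I.encode.map InputSymbol.toToken =
    inputTokens I.minCandidates.bits I.minVoters.bits I.candWords I.rankingWords := by
  simp only [HiddenIDInstance.encode, List.map_append, encodeNumber_map_toToken,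
    encodeNumbers_map_toToken, List.map_flatMap, inputTokens, HiddenIDInstance.candWords,
    HiddenIDInstance.rankingWords, List.flatMap_map]
  simp [encWord, encRanking, List.flatMap_map]

theorem sublist_map_bits_iff {m : ℕ} (s r : List (Fin m)) :
    (s.map fun c => c.val.bits).Sublist (r.map fun c => c.val.bits) ↔ s.Sublist r := by
  have hinj : Function.Injective fun c : Fin m => c.val.bits := by
    intro c d h
    have := congrArg binValue h
    rw [binValue_bits, binValue_bits] at this
    exact Fin.ext this
  refine ⟨fun h => ?_, fun h => h.map _⟩
  obtain ⟨s', hs', he⟩ := List.sublist_map_iff.1 h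
  rwa [hinj.list_map he]

theorem countP_rankingWords (I : HiddenIDInstance) (s : List (Fin I.numCandidates)) :
    I.rankingWords.countP (fun r => decide ((s.map fun c => c.val.bits).Sublist r)) =
      (List.finRange I.numVoters).countP
          (fun v => decide (s.Sublist (I.election.rankingList v))) := by
  rw [HiddenIDInstance.rankingWords, List.countP_map]
  refine List.countP_congr fun v _ => ?_
  simp [sublist_map_bits_iff]

theorem mem_hiddenID_iff_words (I : HiddenIDInstance) : I ∈ HiddenID ↔
    binValue I.minCandidates.bits ≤ I.candWords.length ∧
    binValue I.minVoters.bits ≤ I.rankingWords.length ∧ ∃ s : List (List Bool),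
      s.length = min (binValue I.minCandidates.bits) I.candWords.length ∧
      (∀ c ∈ s, c ∈ I.candWords) ∧ min (binValue I.minVoters.bits) I.rankingWords.length ≤
        I.rankingWords.countP (fun r => decide (s.Sublist r)) := by
  have h₁ : I.candWords.length = I.numCandidates := by simp [HiddenIDInstance.candWords]
  have h₂ : I.rankingWords.length = I.numVoters := by simp [HiddenIDInstance.rankingWords]
  rw [mem_hiddenID_iff, binValue_bits, binValue_bits, h₁, h₂]
  refine and_congr_right fun hm => and_congr_right fun hn => ?_
  rw [min_eq_left hm, min_eq_left hn]
  constructor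
  · rintro ⟨s, hs, hc⟩
    refine ⟨s.map fun c => c.val.bits, by simpa using hs, ?_, by rwa [countP_rankingWords]⟩
    intro w hw
    obtain ⟨c, -, rfl⟩ := List.mem_map.1 hw
    exact List.mem_map.2 ⟨c, List.mem_finRange c, rfl⟩
  · rintro ⟨s, hs, hmem, hc⟩
    obtain ⟨s, rfl⟩ : ∃ s' : List (Fin I.numCandidates), s'.map (fun c => c.val.bits) = s := by
      have : s ∈ Set.range (List.map fun c : Fin I.numCandidates => c.val.bits) := by
        rw [Set.range_list_map]
        intro w hw
        obtain ⟨c, -, rfl⟩ := List.mem_map.1 (hmem w hw)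
        exact ⟨c, rfl⟩
      exact this
    exact ⟨s, by simpa using hs, by rwa [countP_rankingWords] at hc⟩

/-! ### Time bounds for the two parameterizations. -/

theorem decidableInTime_hiddenID {T : HiddenIDInstance → ℕ}
    (hT : ∀ I : HiddenIDInstance, I.encode.length + 200 * ((I.numCandidates + 1) ^
      min I.minCandidates I.numCandidates * (I.encode.length + 1) ^ 3) + 2 ≤ T I) :
    DecidableInTime HiddenIDInstance.encode HiddenID T := by
  classical
  refine StackProg.decidableInTime hiddenIDProg InputSymbol.toToken .buf .res .semi
    (fun I => ⟨decide (I ∈ HiddenID), by simp, ?_⟩) hT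
  have h := exec_hiddenIDProg I.minCandidates.bits I.minVoters.bits I.candWords I.rankingWords
    (decide (I ∈ HiddenID)) (by rw [decide_eq_true_iff, mem_hiddenID_iff_words])
  have h₁ : I.candWords.length = I.numCandidates := by simp [HiddenIDInstance.candWords]
  rwa [← encode_map_toToken, List.length_map, binValue_bits, h₁] at h

/-- One comma per candidate, two commas after the numbers, and a bar. This bounds the base `|C| + 1`
by `|x|` and gives `|x| ≥ 3`. -/
theorem length_encode (I : HiddenIDInstance) : I.numCandidates + 3 ≤ I.encode.length := by
  have h := congrArg List.length (encode_map_toToken I)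
  have h₁ : I.candWords.length = I.numCandidates := by simp [HiddenIDInstance.candWords]
  have h₂ := length_le_length_flatMap_encWord I.candWords
  simp only [List.length_map, inputTokens, List.length_append, List.length_cons] at h
  omega

theorem mainTheorem7 :
    InFPT HiddenIDInstance.encode HiddenID (fun I => I.numCandidates) ∧
      InXP HiddenIDInstance.encode HiddenID (fun I => I.minCandidates) := by
  constructor
  -- `203 = 200 + 3`, where the 3 absorbs the additive `|x| + 2`.
  · refine ⟨fun k => (k + 1) ^ k, 203 * (Polynomial.X + 1) ^ 3, ?_, decidableInTime_hiddenID ?_⟩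
    · exact ((Primrec₂.unpaired'.1 Nat.Primrec.pow).comp Primrec.succ Primrec.id).to_comp
    · intro I
      have he : (203 * (Polynomial.X + 1) ^ 3 : Polynomial ℕ).eval I.encode.length =
          203 * (I.encode.length + 1) ^ 3 := by
        simp
      rw [he]
      set n := I.encode.length
      have h₁ : (I.numCandidates + 1) ^ min I.minCandidates I.numCandidates * (n + 1) ^ 3 ≤
          (I.numCandidates + 1) ^ I.numCandidates * (n + 1) ^ 3 :=
        Nat.mul_le_mul_right _ (Nat.pow_le_pow_right (by omega) (min_le_right _ _))
      have h₂ : (n + 1) ^ 3 ≤ (I.numCandidates + 1) ^ I.numCandidates * (n + 1) ^ 3 :=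
        Nat.le_mul_of_pos_left _ (by positivity)
      have h₃ : n + 1 ≤ (n + 1) ^ 3 := Nat.le_self_pow (by omega) _
      have h₄ : (I.numCandidates + 1) ^ I.numCandidates * (203 * (n + 1) ^ 3) =
        203 * ((I.numCandidates + 1) ^ I.numCandidates * (n + 1) ^ 3) := by ring
      rw [h₄]
      omega
  -- `11 = 6 + 5`: `n ^ 6` bounds `(n + 1) ^ 3`, and `n ^ 5 ≥ 3 ^ 5 = 243` absorbs the factor 200
  -- and the additive terms.
  · refine ⟨fun k => k + 11, ?_, decidableInTime_hiddenID ?_⟩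
    · exact (Primrec.nat_add.comp Primrec.id (Primrec.const 11)).to_comp
    · intro I
      have hn := length_encode I
      set n := I.encode.length
      have h₁ : (I.numCandidates + 1) ^ min I.minCandidates I.numCandidates ≤
          n ^ I.minCandidates :=
        (Nat.pow_le_pow_left (by omega) _).trans (Nat.pow_le_pow_right (by omega) (min_le_left _ _))
      have h₂ : (n + 1) ^ 3 ≤ n ^ 6 := by
        have : n + 1 ≤ n ^ 2 := by nlinarith
        calc (n + 1) ^ 3 ≤ (n ^ 2) ^ 3 := Nat.pow_le_pow_left this 3
          _ = n ^ 6 := by ring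
      have h₃ := Nat.mul_le_mul h₁ h₂
      have h₄ : 243 ≤ n ^ 5 := (Nat.pow_le_pow_left (show 3 ≤ n by omega) 5)
      have h₅ := Nat.mul_le_mul_right (n ^ I.minCandidates * n ^ 6) h₄
      have h₆ : n ^ (I.minCandidates + 11) = n ^ 5 * (n ^ I.minCandidates * n ^ 6) := by ring
      have h₇ : n ≤ n ^ I.minCandidates * n ^ 6 :=
        (Nat.le_self_pow (by omega) n).trans (Nat.le_mul_of_pos_left _ (Nat.pow_pos (by omega)))
      rw [h₆]
      omega
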